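/- **Notation.** Let $n\in\mathbb N$ and $r\in(0,+\infty]$. Let $W_n$ be the set of all words $\alpha=(\alpha_1,\dots,\alpha_d)$, $d\ge 0$, in the letters $1,\dots,n$; put $|\alpha|=d$ and $\zeta_\alpha=\zeta_{\alpha_1}\cdots\zeta_{\alpha_d}$. For $d\ge 1$ let $s(\alpha)$ be the number of $i\in\{1,\dots,d-1\}$ with $\alpha_i\ne\alpha_{i+1}$, and let $s(\alpha)=-1$ if $d=0$. Consider the algebras of noncommutative power series (with multiplication given by concatenation of words) $$\mathcal F(\mathbb D_r^n)=\Bigl\{a=\sum_{\alpha\in W_n}c_\alpha\zeta_\alpha:\ \|a\|_{\rho,\tau}=\sum_\alpha|c_\alpha|\rho^{|\alpha|}\tau^{s(\alpha)+1}<\infty\ \ \forall \rho\in(0,r),\ \forall\tau\ge1\Bigr\},$$ $$\mathcal F^{\mathrm T}(\mathbb D_r^n)=\Bigl\{a=\sum_{\alpha\in W_n}c_\alpha\zeta_\alpha:\ \|a\|_{\rho}=\sum_\alpha|c_\alpha|\rho^{|\alpha|}<\infty\ \ \forall \rho\in(0,r)\Bigr\},$$ topologized by the norms $\|\cdot\|_{\rho,\tau}$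 and $\|\cdot\|_\rho$, respectively. For $F=\mathcal F(\mathbb D_r^n)$ or $F=\mathcal F^{\mathrm T}(\mathbb D_r^n)$ let $\mathcal O(\mathbb C^\times,F)$ be the algebra of holomorphic $F$-valued functions on $\mathbb C^\times=\mathbb C\setminus\{0\}$ with the compact-open topology; it is an algebra over $\mathcal O(\mathbb C^\times)=\mathcal O(\mathbb C^\times,\mathbb C)$. Let $z\in\mathcal O(\mathbb C^\times)$ be the coordinate, let $I_{\mathbb D}\subset\mathcal O(\mathbb C^\times,\mathcal F(\mathbb D_r^n))$ and $I_{\mathbb D}^{\mathrm T}\subset\mathcal O(\mathbb C^\times,\mathcal F^{\mathrm T}(\mathbb D_r^n))$ be the closed two-sided ideals generated by the elements $\zeta_i\zeta_j-z\zeta_j\zeta_i$ ($i<j$), and define topological $\mathcal O(\mathbb C^\times)$-algebras (with the quotient topologies) $$\mathcal O_{\mathrm{def}}(\mathbb D_r^n)=\mathcal O(\mathbb C^\times,\mathcal F(\mathbb D_r^n))/I_{\mathbb D},\qquad \mathcal O_{\mathrm{def}}^{\mathrm T}(\mathbb D_r^n)=\mathcal O(\mathbb C^\times,\mathcal F^{\mathrm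 T}(\mathbb D_r^n))/I_{\mathbb D}^{\mathrm T}.$$ Let $x_i\in\mathcal O_{\mathrm{def}}(\mathbb D_r^n)$ be the class of $\zeta_i$, and let $i_{\mathbb D\mathbb D}:\mathcal O_{\mathrm{def}}(\mathbb D_r^n)\to\mathcal O_{\mathrm{def}}^{\mathrm T}(\mathbb D_r^n)$ be the continuous $\mathcal O(\mathbb C^\times)$-algebra homomorphism induced by the inclusion $\mathcal F(\mathbb D_r^n)\subset\mathcal F^{\mathrm T}(\mathbb D_r^n)$. **Theorem 8.8.** For each $n\in\mathbb N$ and each $r\in(0,+\infty]$: 1. $i_{\mathbb D\mathbb D}:\mathcal O_{\mathrm{def}}(\mathbb D_r^n)\to\mathcal O_{\mathrm{def}}^{\mathrm T}(\mathbb D_r^n)$ is a topological isomorphism of $\mathcal O(\mathbb C^\times)$-algebras. 2. If $n\ge2$ and $r<\infty$, then $\mathcal F(\mathbb D_r^n)$ and $\mathcal F^{\mathrm T}(\mathbb D_r^n)$ are not isomorphic even as topological vector spaces. 3. The tuple $(x_1,\dots,x_n)$ is strictly spectrally $r$-contractive: for every (unital, complex) Banach algebra $B$ and every continuous unital homomorphism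 $\varphi:\mathcal O_{\mathrm{def}}(\mathbb D_r^n)\to B$, $$\lim_{d\to\infty}\Bigl(\sup_{|\alpha|=d}\|\varphi(x_{\alpha_1}\cdots x_{\alpha_d})\|\Bigr)^{1/d}<r.$$ -/

import Mathlib

open Filter Topology
open scoped ENNReal NNReal

universe u

set_option linter.unusedSectionVars false

namespace FreeDeformation

/-! ### Noncommutative formal power series

Words in the letters `ζ₁, …, ζₙ` are lists over `Fin n`. -/

/-- Formal power series `a = ∑ c_α ζ_α` in `n` noncommuting variables with complex coefficients,
given by the coefficient function `α ↦ c_α`. -/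
@[ext]
structure NCSeries (n : ℕ) : Type where
  coeff : List (Fin n) → ℂ

namespace NCSeries

variable {n : ℕ}

instance : Zero (NCSeries n) := ⟨⟨0⟩⟩
instance : Add (NCSeries n) := ⟨fun a b => ⟨a.coeff + b.coeff⟩⟩
instance : Neg (NCSeries n) := ⟨fun a => ⟨-a.coeff⟩⟩
instance : Sub (NCSeries n) := ⟨fun a b => ⟨a.coeff - b.coeff⟩⟩
instance : SMul ℕ (NCSeries n) := ⟨fun k a => ⟨k • a.coeff⟩⟩
instance : SMul ℤ (NCSeries n) := ⟨fun k a => ⟨k • a.coeff⟩⟩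
instance : SMul ℂ (NCSeries n) := ⟨fun c a => ⟨c • a.coeff⟩⟩

theorem coeff_injective : Function.Injective (coeff : NCSeries n → List (Fin n) → ℂ) :=
  fun _ _ h => NCSeries.ext h

instance : AddCommGroup (NCSeries n) :=
  coeff_injective.addCommGroup _ rfl (fun _ _ => rfl) (fun _ => rfl) (fun _ _ => rfl)
    (fun _ _ => rfl) (fun _ _ => rfl)

instance : Module ℂ (NCSeries n) :=
  coeff_injective.module ℂ ⟨⟨coeff, rfl⟩, fun _ _ => rfl⟩ fun _ _ => rfl

@[simp] theorem coeff_add (a b : NCSeries n) (w) : (a + b).coeff w = a.coeff w + b.coeff w := rfl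
@[simp] theorem coeff_zero (w) : (0 : NCSeries n).coeff w = 0 := rfl
@[simp] theorem coeff_smul (c : ℂ) (a : NCSeries n) (w) : (c • a).coeff w = c * a.coeff w := rfl

/-- Multiplication extends concatenation of words: the coefficient of `ab` at `w` is the sum of
`a_u b_v` over all decompositions `w = uv`. -/
instance : Mul (NCSeries n) :=
  ⟨fun a b =>
    ⟨fun w => ∑ i ∈ Finset.range (w.length + 1), a.coeff (w.take i) * b.coeff (w.drop i)⟩⟩

/-- The unit is the empty word. -/
instance : One (NCSeries n) := ⟨⟨fun w => if w = [] then 1 else 0⟩⟩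

theorem coeff_one (w : List (Fin n)) : (1 : NCSeries n).coeff w = if w = [] then 1 else 0 := rfl

theorem coeff_mul (a b : NCSeries n) (w) : (a * b).coeff w =
    ∑ i ∈ Finset.range (w.length + 1), a.coeff (w.take i) * b.coeff (w.drop i) := rfl

theorem coeff_mul_nil (a b : NCSeries n) : (a * b).coeff [] = a.coeff [] * b.coeff [] := by
  simp [coeff_mul]

theorem coeff_mul_cons (a b : NCSeries n) (x : Fin n) (w : List (Fin n)) :
    (a * b).coeff (x :: w) =
      ((⟨fun v => a.coeff (x :: v)⟩ : NCSeries n) * b).coeff w + a.coeff [] * b.coeff (x :: w) := by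
  rw [coeff_mul, coeff_mul, List.length_cons, Finset.sum_range_succ']
  simp

protected theorem mul_assoc_coeff (w : List (Fin n)) (a b c : NCSeries n) :
    (a * b * c).coeff w = (a * (b * c)).coeff w := by
  induction w generalizing a b c with
  | nil => simp only [coeff_mul_nil]; ring
  | cons x w ih =>
    have h1 : (⟨fun v => (a * b).coeff (x :: v)⟩ : NCSeries n) =
        (⟨fun v => a.coeff (x :: v)⟩ : NCSeries n) * b
          + a.coeff [] • (⟨fun v => b.coeff (x :: v)⟩ : NCSeries n) := by
      ext v; rw [coeff_add, coeff_smul]; exact coeff_mul_cons a b x v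
    have h2 : ∀ (s t : NCSeries n) (k : ℂ),
        ((s + k • t) * c).coeff w = (s * c).coeff w + k * (t * c).coeff w := by
      intro s t k
      simp only [coeff_mul, coeff_add, coeff_smul, Finset.mul_sum, ← Finset.sum_add_distrib]
      exact Finset.sum_congr rfl fun _ _ => by ring
    rw [coeff_mul_cons (a * b), coeff_mul_cons a (b * c), coeff_mul_cons b c, h1, h2, ih,
      coeff_mul_nil]
    ring

instance : Ring (NCSeries n) where
  left_distrib a b c := by
    ext w; simp [coeff_mul, mul_add, Finset.sum_add_distrib]
  right_distrib a b c := by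
    ext w; simp [coeff_mul, add_mul, Finset.sum_add_distrib]
  zero_mul a := by ext w; simp [coeff_mul]
  mul_zero a := by ext w; simp [coeff_mul]
  mul_assoc a b c := by ext w; exact NCSeries.mul_assoc_coeff w a b c
  one_mul a := by
    ext w
    rw [coeff_mul, Finset.sum_eq_single 0]
    · simp [coeff_one]
    · intro i hi h0
      have : ¬ (w = []) := by
        rintro rfl; simp at hi; exact h0 hi
      simp [coeff_one, h0, this]
    · simp
  mul_one a := by
    ext w
    rw [coeff_mul, Finset.sum_eq_single w.length]
    · simp [coeff_one]
    · intro i hi h0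
      have : ¬ (w.length ≤ i) := by
        have := Finset.mem_range.1 hi
        omega
      simp [coeff_one, this]
    · simp
  neg_add_cancel a := neg_add_cancel a
  zsmul := (· • ·)
  zsmul_zero' a := zero_smul ℤ a
  zsmul_succ' k a := SubNegMonoid.zsmul_succ' k a
  zsmul_neg' k a := SubNegMonoid.zsmul_neg' k a

instance : Algebra ℂ (NCSeries n) :=
  Algebra.ofModule
    (fun c a b => by
      ext w
      simp only [coeff_mul, coeff_smul, Finset.mul_sum]
      exact Finset.sum_congr rfl fun _ _ => by ring)
    (fun c a b => by
      ext w
      simp only [coeff_mul, coeff_smul, Finset.mul_sum]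
      exact Finset.sum_congr rfl fun _ _ => by ring)

/-- The series consisting of the single word `w`. -/
def word (w : List (Fin n)) : NCSeries n := ⟨fun v => if v = w then 1 else 0⟩

end NCSeries

/-! ### Algebras of weighted absolutely summable series -/

/-- A submultiplicative weight on words. -/
structure Weight (n : ℕ) where
  toFun : List (Fin n) → ℝ
  nonneg' : ∀ w, 0 ≤ toFun w
  append_le' : ∀ u v, toFun (u ++ v) ≤ toFun u * toFun v

variable {n : ℕ}

/-- A word together with a place where it is cut is the same as a pair of words. -/
def cutEquiv (n : ℕ) :
    (Σ w : List (Fin n), Fin (w.length + 1)) ≃ List (Fin n) × List (Fin n) where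
  toFun p := (p.1.take p.2, p.1.drop p.2)
  invFun q := ⟨q.1 ++ q.2, ⟨q.1.length, by simp⟩⟩
  left_inv := by
    rintro ⟨w, i, hi⟩
    have hi' : i ≤ w.length := by omega
    simp only [Sigma.mk.injEq, List.take_append_drop, true_and]
    refine (Fin.heq_ext_iff ?_).2 ?_
    · simp
    · simpa using hi'
  right_inv := by rintro ⟨u, v⟩; simp

theorem norm_mul_le_cut (ω : Weight n) (a b : NCSeries n) (w : List (Fin n)) :
    ‖(a * b).coeff w‖ * ω.toFun w ≤ ∑ i : Fin (w.length + 1),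
      (‖a.coeff (w.take i)‖ * ω.toFun (w.take i)) * (‖b.coeff (w.drop i)‖ * ω.toFun (w.drop i)) := by
  rw [NCSeries.coeff_mul, Finset.sum_range]
  refine (mul_le_mul_of_nonneg_right (norm_sum_le _ _) (ω.nonneg' w)).trans ?_
  rw [Finset.sum_mul]
  refine Finset.sum_le_sum fun i _ => ?_
  have h := ω.append_le' (w.take i) (w.drop i)
  rw [List.take_append_drop] at h
  rw [norm_mul]
  calc ‖a.coeff (w.take i)‖ * ‖b.coeff (w.drop i)‖ * ω.toFun w
      ≤ ‖a.coeff (w.take i)‖ * ‖b.coeff (w.drop i)‖ * (ω.toFun (w.take i) * ω.toFun (w.drop i)) :=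
        mul_le_mul_of_nonneg_left h (by positivity)
    _ = _ := by ring

theorem summable_mul_and_tsum_le (ω : Weight n) {a b : NCSeries n}
    (ha : Summable fun w => ‖a.coeff w‖ * ω.toFun w) (hb : Summable fun w => ‖b.coeff w‖ * ω.toFun w) :
    (Summable fun w => ‖(a * b).coeff w‖ * ω.toFun w) ∧
      ∑' w, ‖(a * b).coeff w‖ * ω.toFun w ≤
        (∑' w, ‖a.coeff w‖ * ω.toFun w) * ∑' w, ‖b.coeff w‖ * ω.toFun w := by
  have ha0 : ∀ w, 0 ≤ ‖a.coeff w‖ * ω.toFun w := fun w => mul_nonneg (norm_nonneg _) (ω.nonneg' w)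
  have hb0 : ∀ w, 0 ≤ ‖b.coeff w‖ * ω.toFun w := fun w => mul_nonneg (norm_nonneg _) (ω.nonneg' w)
  have hP := ha.mul_of_nonneg hb ha0 hb0
  have hS := (cutEquiv n).summable_iff.2 hP
  have hs : Summable fun w : List (Fin n) => ∑ i : Fin (w.length + 1),
      (‖a.coeff (w.take i)‖ * ω.toFun (w.take i)) * (‖b.coeff (w.drop i)‖ * ω.toFun (w.drop i)) := by
    have := hS.sigma
    simp only [tsum_fintype] at this
    exact this
  have hsum := Summable.of_nonneg_of_le
    (fun w => mul_nonneg (norm_nonneg ((a * b).coeff w)) (ω.nonneg' w)) (norm_mul_le_cut ω a b) hs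
  refine ⟨hsum, ?_⟩
  rw [ha.tsum_mul_tsum hb hP, ← (cutEquiv n).tsum_eq]
  refine le_of_le_of_eq ?_ hS.tsum_sigma.symm
  refine hsum.tsum_le_tsum (fun w => ?_) ?_
  · rw [tsum_fintype]; exact norm_mul_le_cut ω a b w
  · simp only [tsum_fintype]; exact hs

/-- The algebra of all series `a = ∑ c_α ζ_α` such that `∑ |c_α| ω(α) < ∞` for every weight `ω`
from a given set `W`. -/
def WordAlgebra (W : Set (Weight n)) : Subalgebra ℂ (NCSeries n) where
  carrier := {a | ∀ ω ∈ W, Summable fun w => ‖a.coeff w‖ * ω.toFun w}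
  mul_mem' ha hb ω hω := (summable_mul_and_tsum_le ω (ha ω hω) (hb ω hω)).1
  add_mem' {a b} ha hb ω hω := by
    refine Summable.of_nonneg_of_le (fun w => mul_nonneg (norm_nonneg _) (ω.nonneg' w))
      (fun w => ?_) ((ha ω hω).add (hb ω hω))
    rw [← add_mul]
    exact mul_le_mul_of_nonneg_right (norm_add_le _ _) (ω.nonneg' w)
  algebraMap_mem' c ω _ := by
    refine summable_of_ne_finset_zero (s := {[]}) fun w hw => ?_
    have : ¬ (w = []) := by simpa using hw
    rw [Algebra.algebraMap_eq_smul_one]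
    simp [NCSeries.coeff_one, this]

/-- The seminorm `‖a‖_ω = ∑ |c_α| ω(α)`. -/
noncomputable def wordSeminorm (W : Set (Weight n)) (ω : W) : Seminorm ℂ (WordAlgebra W) :=
  Seminorm.of (fun a => ∑' w, ‖(a : NCSeries n).coeff w‖ * ω.1.toFun w)
    (fun a b => by
      rw [← (a.2 ω.1 ω.2).tsum_add (b.2 ω.1 ω.2)]
      refine ((a + b).2 ω.1 ω.2).tsum_le_tsum (fun w => ?_) ((a.2 ω.1 ω.2).add (b.2 ω.1 ω.2))
      rw [← add_mul]
      exact mul_le_mul_of_nonneg_right (norm_add_le _ _) (ω.1.nonneg' w))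
    (fun c a => by
      rw [← tsum_mul_left]
      refine tsum_congr fun w => ?_
      change ‖c * (a : NCSeries n).coeff w‖ * _ = _
      rw [norm_mul]; ring)

/-- The topology defined by the seminorms `‖·‖_ω`, `ω ∈ W`. -/
noncomputable instance (W : Set (Weight n)) : TopologicalSpace (WordAlgebra W) :=
  ⨅ ω : W, (wordSeminorm W ω).toSeminormedAddCommGroup.toUniformSpace.toTopologicalSpace

instance (W : Set (Weight n)) : IsTopologicalAddGroup (WordAlgebra W) :=
  topologicalAddGroup_iInf fun ω =>
    letI := (wordSeminorm W ω).toSeminormedAddCommGroup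
    inferInstance

theorem wordSeminorm_mul_le (W : Set (Weight n)) (ω : W) (a b : WordAlgebra W) :
    wordSeminorm W ω (a * b) ≤ wordSeminorm W ω a * wordSeminorm W ω b :=
  (summable_mul_and_tsum_le ω.1 (a.2 ω.1 ω.2) (b.2 ω.1 ω.2)).2

instance (W : Set (Weight n)) : IsTopologicalRing (WordAlgebra W) where
  continuous_mul := (continuousMul_iInf fun ω : W =>
    let i : SeminormedRing (WordAlgebra W) :=
      { (wordSeminorm W ω).toSeminormedAddCommGroup, (inferInstance : Ring (WordAlgebra W)) with
        norm_mul_le := wordSeminorm_mul_le W ω }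
    @NonUnitalSeminormedRing.toContinuousMul _ i.toNonUnitalSeminormedRing).continuous_mul

instance (W : Set (Weight n)) : ContinuousSMul ℂ (WordAlgebra W) :=
  continuousSMul_iInf fun ω : W =>
    letI := (wordSeminorm W ω).toSeminormedAddCommGroup
    letI : NormedSpace ℂ (WordAlgebra W) :=
      { norm_smul_le := fun c a => (map_smul_eq_mul (wordSeminorm W ω) c a).le }
    inferInstance

/-- The generator `ζ_i`. -/
noncomputable def zeta (W : Set (Weight n)) (i : Fin n) : WordAlgebra W :=
  ⟨NCSeries.word [i], fun ω _ => summable_of_ne_finset_zero (s := {[i]}) fun w hw => by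
    have : ¬ (w = [i]) := by simpa using hw
    simp [NCSeries.word, this]⟩

/-- If `W' ⊆ W`, then the algebra for `W` is continuously contained in the algebra for `W'`. -/
noncomputable def wordInclusion {W' W : Set (Weight n)} (h : W' ⊆ W) :
    WordAlgebra W →A[ℂ] WordAlgebra W' where
  toAlgHom := Subalgebra.inclusion fun _ ha ω hω => ha ω (h hω)
  cont := by
    refine continuous_iInf_rng.2 fun ω => ?_
    refine continuous_iInf_dom (i := (⟨ω.1, h ω.2⟩ : W)) ?_
    let := (wordSeminorm W ⟨ω.1, h ω.2⟩).toSeminormedAddCommGroup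
    let := (wordSeminorm W' ω).toSeminormedAddCommGroup
    exact (AddMonoidHomClass.isometry_of_norm
      (Subalgebra.inclusion (S := WordAlgebra W) (T := WordAlgebra W')
        fun _ ha ω hω => ha ω (h hω)).toLinearMap fun _ => rfl).continuous

theorem wordInclusion_zeta {W' W : Set (Weight n)} (h : W' ⊆ W) (i : Fin n) :
    wordInclusion h (zeta W i) = zeta W' i := rfl

/-! ### The two algebras of holomorphic functions on the free polydisk -/

/-- The number of indices at which consecutive letters of a word are different. -/
def changes : List (Fin n) → ℕ
  | [] => 0
  | [_] => 0
  | i :: j :: w => (if i ≠ j then 1 else 0) + changes (j :: w)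

/-- The number `s(α) + 1`, where `s(α)` is the number of changes of letters in a nonempty word
`α`, and `s(α) = -1` for the empty word. -/
def blocks : List (Fin n) → ℕ
  | [] => 0
  | i :: w => changes (i :: w) + 1

theorem blocks_cons_cons (i j : Fin n) (w : List (Fin n)) :
    blocks (i :: j :: w) = (if i ≠ j then 1 else 0) + blocks (j :: w) := by
  simp [blocks, changes, add_assoc]

theorem blocks_append_le (u v : List (Fin n)) : blocks (u ++ v) ≤ blocks u + blocks v := by
  induction u with
  | nil => simp
  | cons i u ih =>
    cases u with
    | nil =>
      cases v with
      | nil => simp [blocks, changes]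
      | cons j v =>
        rw [List.singleton_append, blocks_cons_cons]
        simp only [blocks, changes]
        split_ifs <;> omega
    | cons k u =>
      rw [List.cons_append, List.cons_append, blocks_cons_cons, blocks_cons_cons]
      rw [List.cons_append] at ih
      omega

/-- The weight `α ↦ ρ^{|α|} τ^{s(α)+1}`. -/
def polydiskWeight (n : ℕ) (ρ τ : ℝ) (hρ : 0 < ρ) (hτ : 1 ≤ τ) : Weight n where
  toFun w := ρ ^ w.length * τ ^ blocks w
  nonneg' w := by positivity
  append_le' u v := by
    have h := pow_le_pow_right₀ hτ (blocks_append_le u v)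
    rw [List.length_append, pow_add]
    calc ρ ^ u.length * ρ ^ v.length * τ ^ blocks (u ++ v)
        ≤ ρ ^ u.length * ρ ^ v.length * τ ^ (blocks u + blocks v) :=
          mul_le_mul_of_nonneg_left h (by positivity)
      _ = _ := by rw [pow_add]; ring

/-- The weights `ρ^{|α|} τ^{s(α)+1}` with `0 < ρ < r` and `τ ≥ 1`. -/
def polydiskWeights (n : ℕ) (r : ℝ≥0∞) : Set (Weight n) :=
  {ω | ∃ (ρ τ : ℝ) (hρ : 0 < ρ) (hτ : 1 ≤ τ), ENNReal.ofReal ρ < r ∧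
    ω = polydiskWeight n ρ τ hρ hτ}

/-- The weight `α ↦ ρ^{|α|}`. -/
def taylorWeight (n : ℕ) (ρ : ℝ) (hρ : 0 < ρ) : Weight n where
  toFun w := ρ ^ w.length
  nonneg' w := by positivity
  append_le' u v := by rw [List.length_append, pow_add]

/-- The weights `ρ^{|α|}` with `0 < ρ < r`. -/
def taylorWeights (n : ℕ) (r : ℝ≥0∞) : Set (Weight n) :=
  {ω | ∃ (ρ : ℝ) (hρ : 0 < ρ), ENNReal.ofReal ρ < r ∧ ω = taylorWeight n ρ hρ}

theorem taylorWeights_subset (n : ℕ) (r : ℝ≥0∞) : taylorWeights n r ⊆ polydiskWeights n r := by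
  rintro ω ⟨ρ, hρ, hr, rfl⟩
  exact ⟨ρ, 1, hρ, le_rfl, hr, by simp [taylorWeight, polydiskWeight]⟩

/-- `𝓕(𝔻_r^n)`: the series with `∑ |c_α| ρ^{|α|} τ^{s(α)+1} < ∞` for all `0 < ρ < r`, `τ ≥ 1`. -/
abbrev FreePolydisk (n : ℕ) (r : ℝ≥0∞) : Type := WordAlgebra (polydiskWeights n r)

/-- `𝓕ᵀ(𝔻_r^n)`: the series with `∑ |c_α| ρ^{|α|} < ∞` for all `0 < ρ < r`. -/
abbrev TaylorFreePolydisk (n : ℕ) (r : ℝ≥0∞) : Type := WordAlgebra (taylorWeights n r)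

/-! ### Holomorphic functions on the punctured plane -/

/-- The punctured plane `ℂ^×`. -/
abbrev CStar : Type := {z : ℂ // z ≠ 0}

section Hol

variable {A B : Type*} [Ring A] [Algebra ℂ A] [TopologicalSpace A] [IsTopologicalRing A]
  [ContinuousSMul ℂ A] [Ring B] [Algebra ℂ B] [TopologicalSpace B] [IsTopologicalRing B]
  [ContinuousSMul ℂ B]

/-- A map from `ℂ^×` to a topological vector space is holomorphic if it has a complex derivative
at every point. -/
def IsHolomorphic {A : Type*} [AddCommGroup A] [Module ℂ A] [TopologicalSpace A]
    (f : CStar → A) : Prop :=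
  ∀ z : CStar, ∃ L : A,
    Tendsto (fun w : CStar => ((w : ℂ) - (z : ℂ))⁻¹ • (f w - f z)) (𝓝[≠] z) (𝓝 L)

theorem IsHolomorphic.const (a : A) : IsHolomorphic fun _ : CStar => a :=
  fun _ => ⟨0, by simpa using tendsto_const_nhds⟩

theorem IsHolomorphic.add {f g : CStar → A} (hf : IsHolomorphic f) (hg : IsHolomorphic g) :
    IsHolomorphic fun z => f z + g z := by
  intro z
  obtain ⟨L, hL⟩ := hf z
  obtain ⟨M, hM⟩ := hg z
  refine ⟨L + M, (hL.add hM).congr fun w => ?_⟩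
  rw [← smul_add, add_sub_add_comm]

theorem IsHolomorphic.mul {f g : CStar → A} (hf : IsHolomorphic f) (hg : IsHolomorphic g)
    (hc : Continuous f) : IsHolomorphic fun z => f z * g z := by
  intro z
  obtain ⟨L, hL⟩ := hf z
  obtain ⟨M, hM⟩ := hg z
  have hfz : Tendsto f (𝓝[≠] z) (𝓝 (f z)) := (hc.tendsto z).mono_left nhdsWithin_le_nhds
  refine ⟨L * g z + f z * M, ((hL.mul_const (g z)).add (hfz.mul hM)).congr fun w => ?_⟩
  rw [smul_mul_assoc, mul_smul_comm, ← smul_add]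
  congr 1
  noncomm_ring

theorem IsHolomorphic.comp {f : CStar → A} (hf : IsHolomorphic f) (φ : A →A[ℂ] B) :
    IsHolomorphic fun z => φ (f z) := by
  intro z
  obtain ⟨L, hL⟩ := hf z
  refine ⟨φ L, ((φ.continuous.tendsto L).comp hL).congr fun w => ?_⟩
  simp [map_sub]

variable (A) in
/-- Holomorphic `A`-valued functions on `ℂ^×`, as a subalgebra of the algebra `C(ℂ^×, A)` of
continuous functions (holomorphic functions are continuous). -/
noncomputable def holSubalgebra : Subalgebra ℂ C(CStar, A) where
  carrier := {f | IsHolomorphic f}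
  mul_mem' {f _} hf hg := IsHolomorphic.mul hf hg f.continuous
  add_mem' hf hg := IsHolomorphic.add hf hg
  algebraMap_mem' c := IsHolomorphic.const (algebraMap ℂ A c)

variable (A) in
/-- The algebra `𝓞(ℂ^×, A)` of holomorphic `A`-valued functions on `ℂ^×` with pointwise operations
and with the topology of uniform convergence on compact sets, that is, the topology induced by
the compact-open topology of `C(ℂ^×, A)`. -/
def Hol : Type _ := holSubalgebra A

namespace Hol

noncomputable instance : Ring (Hol A) := inferInstanceAs (Ring (holSubalgebra A))

noncomputable instance : Algebra ℂ (Hol A) := inferInstanceAs (Algebra ℂ (holSubalgebra A))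

noncomputable instance : CommRing (Hol ℂ) :=
  { (inferInstance : Ring (Hol ℂ)) with
    mul_comm := fun f g => Subtype.ext (mul_comm f.1 g.1) }

instance : TopologicalSpace (Hol A) := inferInstanceAs (TopologicalSpace (holSubalgebra A))

instance : IsTopologicalRing (Hol A) := by
  have hl : LocallyCompactSpace CStar := isOpen_ne.locallyCompactSpace
  have : IsTopologicalRing C(CStar, A) :=
    { continuous_neg := continuous_neg
      continuous_mul := ContinuousMap.continuous_of_continuous_uncurry _ <| by
        have h1 : Continuous fun p : (C(CStar, A) × C(CStar, A)) × CStar => p.1.1 p.2 := by fun_prop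
        have h2 : Continuous fun p : (C(CStar, A) × C(CStar, A)) × CStar => p.1.2 p.2 := by fun_prop
        exact h1.mul h2 }
  exact inferInstanceAs (IsTopologicalRing (holSubalgebra A).toSubring)

noncomputable instance : FunLike (Hol A) CStar A where
  coe f := f.1
  coe_injective _ _ h := Subtype.ext (DFunLike.coe_injective h)

@[ext]
theorem ext {f g : Hol A} (h : ∀ z, f z = g z) : f = g := DFunLike.ext _ _ h

@[simp] theorem add_apply (f g : Hol A) (z : CStar) : (f + g) z = f z + g z := rfl
@[simp] theorem sub_apply (f g : Hol A) (z : CStar) : (f - g) z = f z - g z := rfl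
@[simp] theorem mul_apply (f g : Hol A) (z : CStar) : (f * g) z = f z * g z := rfl
@[simp] theorem one_apply (z : CStar) : (1 : Hol A) z = 1 := rfl
@[simp] theorem zero_apply (z : CStar) : (0 : Hol A) z = 0 := rfl

theorem isHolomorphic (f : Hol A) : IsHolomorphic f := f.2

theorem continuous_coe (f : Hol A) : Continuous f := f.1.continuous

/-- A continuous holomorphic function as an element of `𝓞(ℂ^×, A)`. -/
noncomputable def mk (f : CStar → A) (hc : Continuous f) (hf : IsHolomorphic f) : Hol A := ⟨⟨f, hc⟩, hf⟩

@[simp] theorem mk_apply (f : CStar → A) (hc : Continuous f) (hf : IsHolomorphic f) (z : CStar) :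
    mk f hc hf z = f z := rfl

/-- The constant function with value `a`; this identifies `A` with a subalgebra of
`𝓞(ℂ^×, A)`. -/
noncomputable def const (a : A) : Hol A := mk (fun _ => a) continuous_const (IsHolomorphic.const a)

/-- The complex coordinate `z ∈ 𝓞(ℂ^×)`. -/
noncomputable def coord : Hol ℂ :=
  mk (fun z => (z : ℂ)) continuous_subtype_val fun z => ⟨1, by
    refine tendsto_const_nhds.congr' ?_
    filter_upwards [self_mem_nhdsWithin] with w hw
    have : (w : ℂ) - (z : ℂ) ≠ 0 := sub_ne_zero.2 fun h => hw (Subtype.ext h)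
    simp [this]⟩

theorem continuous_algebraMap' : Continuous (algebraMap ℂ A) := by
  have : (algebraMap ℂ A : ℂ → A) = fun c => c • (1 : A) :=
    funext Algebra.algebraMap_eq_smul_one
  rw [this]
  fun_prop

variable (A) in
/-- The map `f ↦ f ⊗ 1` from `𝓞(ℂ^×)` to `𝓞(ℂ^×, A)`, that is, `z ↦ f(z) 1`. -/
noncomputable def scalar : Hol ℂ →+* Hol A where
  toFun f := mk (fun z => algebraMap ℂ A (f z)) (continuous_algebraMap'.comp f.continuous_coe)
    (f.isHolomorphic.comp ⟨Algebra.ofId ℂ A, continuous_algebraMap'⟩)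
  map_one' := Hol.ext fun _ => map_one (algebraMap ℂ A)
  map_zero' := Hol.ext fun _ => map_zero (algebraMap ℂ A)
  map_mul' _ _ := Hol.ext fun _ => map_mul (algebraMap ℂ A) _ _
  map_add' _ _ := Hol.ext fun _ => map_add (algebraMap ℂ A) _ _

/-- Postcomposition with a continuous homomorphism. -/
noncomputable def map (φ : A →A[ℂ] B) : Hol A →+* Hol B where
  toFun f := mk (fun z => φ (f z)) (φ.continuous.comp f.continuous_coe) (f.isHolomorphic.comp φ)
  map_one' := Hol.ext fun _ => map_one φ
  map_zero' := Hol.ext fun _ => map_zero φ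
  map_mul' _ _ := Hol.ext fun _ => map_mul φ _ _
  map_add' _ _ := Hol.ext fun _ => map_add φ _ _

theorem continuous_map (φ : A →A[ℂ] B) : Continuous (map φ) :=
  Continuous.subtype_mk ((ContinuousMap.continuous_postcomp (⟨φ, φ.continuous⟩ : C(A, B))).comp
    continuous_subtype_val) _

end Hol

end Hol

/-- The structure of an `𝓞(ℂ^×)`-algebra on `𝓞(ℂ^×, F)`. -/
noncomputable instance (W : Set (Weight n)) : Algebra (Hol ℂ) (Hol (WordAlgebra W)) :=
  (Hol.scalar (WordAlgebra W)).toAlgebra' fun f g => by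
    ext1 z; exact Algebra.commutes (f z) (g z)

/-- The action is pointwise: `(f • g)(z) = f(z) g(z)`. -/
theorem Hol.smul_apply (W : Set (Weight n)) (f : Hol ℂ) (g : Hol (WordAlgebra W)) (z : CStar) :
    (f • g) z = f z • g z :=
  (Algebra.smul_def (f z) (g z)).symm

/-- `Hol.map` of the inclusion as a homomorphism of `𝓞(ℂ^×)`-algebras. -/
noncomputable def holInclusion {W' W : Set (Weight n)} (h : W' ⊆ W) :
    Hol (WordAlgebra W) →ₐ[Hol ℂ] Hol (WordAlgebra W') where
  toRingHom := Hol.map (wordInclusion h)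
  commutes' f := by
    ext1 z; exact AlgHomClass.commutes (wordInclusion h) (f z)

theorem continuous_holInclusion {W' W : Set (Weight n)} (h : W' ⊆ W) :
    Continuous (holInclusion h) :=
  Hol.continuous_map (wordInclusion h)

/-! ### Closed two-sided ideals and the deformation algebras -/

section ClosedIdeal

variable {R : Type*} [Ring R] [TopologicalSpace R]

/-- The closed two-sided ideal generated by a set: the smallest one containing it. -/
def closedTwoSidedIdeal (S : Set R) : Ideal R :=
  sInf {J : Ideal R | J.IsTwoSided ∧ IsClosed (J : Set R) ∧ S ⊆ J}

instance (S : Set R) : (closedTwoSidedIdeal S).IsTwoSided where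
  mul_mem_of_left b ha := by
    rw [closedTwoSidedIdeal, Submodule.mem_sInf] at ha ⊢
    intro J hJ
    have := hJ.1
    exact Ideal.mul_mem_right b J (ha J hJ)

theorem isClosed_closedTwoSidedIdeal (S : Set R) :
    IsClosed (closedTwoSidedIdeal S : Set R) := by
  rw [closedTwoSidedIdeal, Submodule.coe_sInf]
  exact isClosed_biInter fun J hJ => hJ.2.1

theorem subset_closedTwoSidedIdeal (S : Set R) : S ⊆ closedTwoSidedIdeal S := by
  intro x hx
  rw [SetLike.mem_coe, closedTwoSidedIdeal, Submodule.mem_sInf]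
  exact fun J hJ => hJ.2.2 hx

theorem closedTwoSidedIdeal_le {S : Set R} {J : Ideal R} (h1 : J.IsTwoSided)
    (h2 : IsClosed (J : Set R)) (h3 : S ⊆ J) : closedTwoSidedIdeal S ≤ J :=
  sInf_le ⟨h1, h2, h3⟩

end ClosedIdeal

/-- The element `ζ_i ζ_j - z ζ_j ζ_i` of `𝓞(ℂ^×, F)`. -/
noncomputable def relation (W : Set (Weight n)) (i j : Fin n) : Hol (WordAlgebra W) :=
  Hol.const (zeta W i) * Hol.const (zeta W j)
    - Hol.coord • (Hol.const (zeta W j) * Hol.const (zeta W i))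

/-- The closed two-sided ideal generated by all `ζ_i ζ_j - z ζ_j ζ_i` with `i < j`. -/
noncomputable def defIdeal (W : Set (Weight n)) : Ideal (Hol (WordAlgebra W)) :=
  closedTwoSidedIdeal {g | ∃ i j : Fin n, i < j ∧ g = relation W i j}

instance (W : Set (Weight n)) : (defIdeal W).IsTwoSided :=
  inferInstanceAs (closedTwoSidedIdeal _).IsTwoSided

/-- The quotient of `𝓞(ℂ^×, F)` by the ideal `defIdeal`, with the quotient topology and the
quotient structure of an algebra over `𝓞(ℂ^×)` (and over `ℂ`). -/
def DefAlgebra (W : Set (Weight n)) : Type := Hol (WordAlgebra W) ⧸ defIdeal W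

noncomputable instance (W : Set (Weight n)) : Ring (DefAlgebra W) :=
  inferInstanceAs (Ring (Hol (WordAlgebra W) ⧸ defIdeal W))

noncomputable instance (W : Set (Weight n)) : Algebra (Hol ℂ) (DefAlgebra W) :=
  inferInstanceAs (Algebra (Hol ℂ) (Hol (WordAlgebra W) ⧸ defIdeal W))

noncomputable instance (W : Set (Weight n)) : Algebra ℂ (DefAlgebra W) :=
  inferInstanceAs (Algebra ℂ (Hol (WordAlgebra W) ⧸ defIdeal W))

/-- The quotient homomorphism. -/
noncomputable def defMk (W : Set (Weight n)) : Hol (WordAlgebra W) →ₐ[Hol ℂ] DefAlgebra W :=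
  Ideal.Quotient.mkₐ (Hol ℂ) (defIdeal W)

/-- The quotient topology. -/
noncomputable instance (W : Set (Weight n)) : TopologicalSpace (DefAlgebra W) :=
  TopologicalSpace.coinduced (defMk W) inferInstance

/-- The image `x_i` of `ζ_i` in the quotient. -/
noncomputable def defGen (W : Set (Weight n)) (i : Fin n) : DefAlgebra W :=
  defMk W (Hol.const (zeta W i))

theorem holInclusion_relation {W' W : Set (Weight n)} (h : W' ⊆ W) (i j : Fin n) :
    holInclusion h (relation W i j) = relation W' i j := by
  rw [relation, map_sub, map_smul, map_mul, map_mul]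
  rfl

theorem defIdeal_le_comap {W' W : Set (Weight n)} (h : W' ⊆ W) :
    defIdeal W ≤ (defIdeal W').comap (holInclusion h) := by
  refine closedTwoSidedIdeal_le inferInstance ?_ ?_
  · exact (isClosed_closedTwoSidedIdeal _).preimage (continuous_holInclusion h)
  · rintro g ⟨i, j, hij, rfl⟩
    rw [SetLike.mem_coe, Ideal.mem_comap, holInclusion_relation]
    exact subset_closedTwoSidedIdeal _ ⟨i, j, hij, rfl⟩

/-- The homomorphism of topological `𝓞(ℂ^×)`-algebras induced by the inclusion of the algebra
for `W` into the algebra for `W' ⊆ W`. -/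
noncomputable def defMap {W' W : Set (Weight n)} (h : W' ⊆ W) :
    DefAlgebra W →A[Hol ℂ] DefAlgebra W' where
  toAlgHom := Ideal.quotientMapₐ (defIdeal W') (holInclusion h) (defIdeal_le_comap h)
  cont := by
    refine continuous_coinduced_dom.2 ?_
    exact continuous_coinduced_rng.comp (continuous_holInclusion h)

theorem defMap_defMk {W' W : Set (Weight n)} (h : W' ⊆ W) (f : Hol (WordAlgebra W)) :
    defMap h (defMk W f) = defMk W' (holInclusion h f) := rfl

/-- `𝓞_def(𝔻_r^n) = 𝓞(ℂ^×, 𝓕(𝔻_r^n)) / I_𝔻`. -/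
abbrev ODef (n : ℕ) (r : ℝ≥0∞) : Type := DefAlgebra (polydiskWeights n r)

/-- `𝓞ᵀ_def(𝔻_r^n) = 𝓞(ℂ^×, 𝓕ᵀ(𝔻_r^n)) / Iᵀ_𝔻`. -/
abbrev ODefT (n : ℕ) (r : ℝ≥0∞) : Type := DefAlgebra (taylorWeights n r)

/-- The canonical map `i_𝔻𝔻 : 𝓞_def(𝔻_r^n) → 𝓞ᵀ_def(𝔻_r^n)`. -/
noncomputable def iDD (n : ℕ) (r : ℝ≥0∞) : ODef n r →A[Hol ℂ] ODefT n r :=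
  defMap (taylorWeights_subset n r)

/-! ### Strictly spectrally contractive tuples -/

/-- The joint `ℓ^∞`-spectral radius of a tuple in a Banach algebra,
`lim_d (sup_{|α| = d} ‖a_α‖)^{1/d}`. The limit always exists, so the upper limit is used. -/
noncomputable def jointSpectralRadius {B : Type*} [NormedRing B] (b : Fin n → B) : ℝ≥0∞ :=
  limsup (fun d : ℕ => (⨆ α : Fin d → Fin n,
    ‖(List.ofFn fun k => b (α k)).prod‖ₑ) ^ ((1 : ℝ) / d)) atTop

/-- A tuple `a` in a topological algebra `A` is strictly spectrally `r`-contractive if for every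
Banach algebra `B` and every continuous homomorphism `φ : A → B` the joint spectral radius of
`φ(a)` is less than `r`. -/
def IsStrictlySpectrallyContractive {A : Type*} [Ring A] [Algebra ℂ A] [TopologicalSpace A]
    (r : ℝ≥0∞) (a : Fin n → A) : Prop :=
  ∀ (B : Type u) [NormedRing B] [NormedAlgebra ℂ B] [CompleteSpace B] (φ : A →A[ℂ] B),
    jointSpectralRadius (fun i => φ (a i)) < r

end FreeDeformation

namespace FreeDeformation

variable {n : ℕ}

/-! ### Rewriting words with few blocks -/

/-! The first and third assertions rest on one combinatorial fact. If `x i * x j = q * (x j * x i)`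
for `i < j` with `q` central, then every monomial equals, with no scalar factor, a monomial of the
same degree whose number of blocks is bounded by a constant depending only on `n`. Sorting the
letters would leave a power of `q` with exponent up to quadratic in the degree, which the weights
cannot control uniformly for all `q = z`. Instead, that power is absorbed by placing copies of the
largest letter on the right, and at most one inside the remaining word (`exists_collect`,
`exists_spread`). Induction on the largest letter gives `exists_prod_eq_of_blocks_le`.

Let `β α` be such a word for `α`. Since `β` preserves length and bounds blocks by `C`, the factor `τ
^ blocks` is at most `τ ^ C` on the range of `β`. The relabelling `ζ_α ↦ ζ_{β α}` is therefore
continuous from the Taylor algebra to the smaller one. It is not multiplicative, but it is so modulo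
the relations (`defMk_holRelabel_mul`). Hence it descends to the quotients and inverts the canonical
map (`exists_defMap_equiv`). The identities are checked on monomials and extended by convergent
expansions (`hol_hasSum`), because the ideals are closed.

For contractivity, a continuous homomorphism to a Banach algebra is bounded on monomials by a single
weight `ρ ^ |α| * τ ^ blocks α` with `ρ < r`. Rewriting with `β` turns `τ ^ blocks` into a constant,
which disappears after taking `d`-th roots.

For non-isomorphy, the obstruction is an interpolation property of the finite-radius Taylor weights:
bounds whose radii approach `r` can be averaged geometrically with one fixed bound, giving a common
radius below `r`. Along alternating words the weights of the other algebra are `(ρ * τ) ^ d` with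
`τ` arbitrarily large, which is incompatible with this. -/

theorem blocks_replicate_le (c : ℕ) (i : Fin n) : blocks (List.replicate c i) ≤ 1 := by
  induction c with
  | zero => simp [blocks]
  | succ c ih =>
    cases c with
    | zero => simp [blocks, changes]
    | succ c =>
      rw [List.replicate_succ, List.replicate_succ, blocks_cons_cons, ← List.replicate_succ]
      simpa using ih

section Commutation

variable {A : Type*} [Ring A] {x : Fin n → A} {q : A}

/-- Moving `x k` leftwards past each smaller letter costs one factor `q`. -/
theorem prod_mul_generator (hq : ∀ a, Commute q a)
    (hx : ∀ i j, i < j → x i * x j = q * (x j * x i)) {k : Fin n} {w : List (Fin n)}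
    (hw : ∀ i ∈ w, i < k) :
    (w.map x).prod * x k = q ^ w.length * (x k * (w.map x).prod) := by
  induction w with
  | nil => simp
  | cons i w ih =>
    rw [List.map_cons, List.prod_cons, mul_assoc, ih fun j hj => hw j (List.mem_cons_of_mem _ hj),
      ← mul_assoc, ← (show Commute (q ^ w.length) (x i) from (hq (x i)).pow_left _),
      mul_assoc, ← mul_assoc (x i), hx i k (hw i List.mem_cons_self), List.length_cons, pow_succ]
    noncomm_ring

theorem prod_mul_generator_pow (hq : ∀ a, Commute q a)
    (hx : ∀ i j, i < j → x i * x j = q * (x j * x i)) {k : Fin n} {w : List (Fin n)}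
    (hw : ∀ i ∈ w, i < k) (p : ℕ) :
    (w.map x).prod * x k ^ p = q ^ (p * w.length) * (x k ^ p * (w.map x).prod) := by
  induction p with
  | zero => simp
  | succ p ih =>
    have hc : Commute (q ^ w.length) (x k ^ p) := (hq (x k ^ p)).pow_left _
    rw [pow_succ, ← mul_assoc, ih, mul_assoc, mul_assoc, prod_mul_generator hq hx hw,
      ← mul_assoc (x k ^ p), ← hc.eq, Nat.add_mul, one_mul, pow_add]
    simp only [mul_assoc]

/-- Collecting the occurrences of the largest letter at the left end of a word. -/
theorem exists_collect (hq : ∀ a, Commute q a)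
    (hx : ∀ i j, i < j → x i * x j = q * (x j * x i)) (k : Fin n) (α : List (Fin n))
    (hα : ∀ i ∈ α, i ≤ k) :
    ∃ (w : List (Fin n)) (p t : ℕ), (∀ i ∈ w, i < k) ∧ p + w.length = α.length ∧
      t ≤ p * w.length ∧ (α.map x).prod = q ^ t * (x k ^ p * (w.map x).prod) := by
  induction α with
  | nil => exact ⟨[], 0, 0, by simp⟩
  | cons i α ih =>
    obtain ⟨w, p, t, hw, hl, ht, h⟩ := ih fun j hj => hα j (List.mem_cons_of_mem _ hj)
    have hc : Commute (q ^ t) (x i) := (hq (x i)).pow_left _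
    rcases (hα i List.mem_cons_self).lt_or_eq with hi | rfl
    · refine ⟨i :: w, p, t + p, ?_, ?_, ?_, ?_⟩
      · simpa using ⟨hi, hw⟩
      · simp; omega
      · simp; nlinarith
      · have := prod_mul_generator_pow hq hx (k := k) (w := [i]) (by simpa using hi) p
        simp only [List.map_cons, List.map_nil, List.prod_cons, List.prod_nil, mul_one,
          List.length_singleton] at this
        rw [List.map_cons, List.prod_cons, h, ← mul_assoc, ← hc.eq, mul_assoc, ← mul_assoc (x i),
          this, pow_add, List.map_cons, List.prod_cons]
        simp only [mul_assoc]
    · refine ⟨w, p + 1, t, hw, ?_, ?_, ?_⟩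
      · simp; omega
      · nlinarith
      · rw [List.map_cons, List.prod_cons, h, ← mul_assoc, ← hc.eq, pow_succ']
        simp only [mul_assoc]

/-- Every power of `q` that can occur in front of `y ^ p * w` can be absorbed by moving letters
`y` to the right in such a way that at most one of them is placed inside `w`. -/
theorem exists_spread (hq : ∀ a, Commute q a)
    (hx : ∀ i j, i < j → x i * x j = q * (x j * x i)) {k : Fin n} {w : List (Fin n)}
    (hw : ∀ i ∈ w, i < k) {p t : ℕ} (ht : t ≤ p * w.length) :
    ∃ (u v : List (Fin n)) (a b c : ℕ), b ≤ 1 ∧ w = u ++ v ∧ a + b + c = p ∧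
      q ^ t * (x k ^ p * (w.map x).prod) =
        x k ^ a * (u.map x).prod * x k ^ b * (v.map x).prod * x k ^ c := by
  -- Division with remainder, `t = e * w.length + m`: a copy of `x k` carried past all of `w`
  -- absorbs `w.length` factors `q`, and one carried past the first `m` letters absorbs `m`. So `e`
  -- copies go to the right end, one goes inside `w`, and `p - 1 - e` stay on the left. In the
  -- extreme case `t = p * w.length`, which includes empty `w`, all copies go to the right.
  by_cases hlt : t < p * w.length
  · have hN : 0 < w.length := Nat.pos_of_ne_zero fun h => by simp [h] at hlt
    have he : t / w.length < p := (Nat.div_lt_iff_lt_mul hN).2 hlt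
    set e := t / w.length with hed
    set m := t % w.length with hmd
    have hm : m < w.length := Nat.mod_lt _ hN
    have htm : t = e * w.length + m := by rw [hed, hmd, mul_comm]; exact (Nat.div_add_mod _ _).symm
    refine ⟨w.take m, w.drop m, p - 1 - e, 1, e, le_rfl, by simp, by omega, ?_⟩
    have h1 := prod_mul_generator hq hx (k := k) (w := w.take m)
      fun i hi => hw i (List.mem_of_mem_take hi)
    have h2 := prod_mul_generator_pow hq hx hw e
    have hlen : (w.take m).length = m := by simp [hm.le]
    have hprod : (w.map x).prod = ((w.take m).map x).prod * ((w.drop m).map x).prod := by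
      rw [← List.prod_append, ← List.map_append, List.take_append_drop]
    rw [hlen] at h1
    have hc (a : A) (j : ℕ) : q ^ j * a = a * q ^ j := (hq a).pow_left j
    calc q ^ t * (x k ^ p * (w.map x).prod)
        = q ^ m * (x k ^ (p - 1 - e) * (x k * (q ^ (e * w.length) * (x k ^ e * (w.map x).prod)))) := by
          rw [show x k ^ p = x k ^ (p - 1 - e) * (x k * x k ^ e) by
            rw [← pow_succ', ← pow_add]; congr 1; omega, htm, add_comm, pow_add, mul_assoc,
            hc (_ * _ : A) (e * w.length), hc (x k ^ e * _) (e * w.length)]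
          simp only [mul_assoc]
      _ = x k ^ (p - 1 - e) * (q ^ m * (x k * ((w.take m).map x).prod)) * ((w.drop m).map x).prod
            * x k ^ e := by
          rw [← h2, hprod, ← mul_assoc (q ^ m), hc (x k ^ _) m]
          simp only [mul_assoc]
      _ = _ := by
          rw [← h1, pow_one]
          simp only [mul_assoc]
  · obtain rfl : t = p * w.length := by omega
    refine ⟨w, [], 0, 0, p, by omega, by simp, by omega, ?_⟩
    simpa using (prod_mul_generator_pow hq hx hw p).symm

/-- Induction on the number of letters allowed. The exponent bound produced by `exists_collect` is
exactly the one `exists_spread` can absorb, so no power of `q` remains. The two pieces of the word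
in smaller letters are then rewritten separately. -/
theorem exists_prod_eq_of_blocks_le_aux (hq : ∀ a, Commute q a)
    (hx : ∀ i j, i < j → x i * x j = q * (x j * x i)) (k : ℕ) :
    ∃ C : ℕ, ∀ α : List (Fin n), (∀ i ∈ α, (i : ℕ) < k) →
      ∃ β : List (Fin n), β.length = α.length ∧ blocks β ≤ C ∧
        (β.map x).prod = (α.map x).prod := by
  induction k with
  | zero =>
    refine ⟨0, fun α hα => ⟨[], ?_⟩⟩
    have : α = [] := List.eq_nil_iff_forall_not_mem.2 fun i hi => by simpa using hα i hi
    simp [this, blocks]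
  | succ k ih =>
    obtain ⟨C, hC⟩ := ih
    -- Two pieces in smaller letters with at most `C` blocks each, and three powers of the largest
    -- letter.
    refine ⟨2 * C + 3, fun α hα => ?_⟩
    by_cases hk : k < n
    · obtain ⟨w, p, t, hw, hl, ht, h⟩ := exists_collect hq hx ⟨k, hk⟩ α
        fun i hi => Fin.le_def.2 (Nat.lt_succ_iff.1 (hα i hi))
      obtain ⟨u, v, a, b, c, hb, rfl, habc, h'⟩ := exists_spread hq hx hw ht
      obtain ⟨u', hu1, hu2, hu3⟩ := hC u fun i hi => hw i (List.mem_append_left _ hi)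
      obtain ⟨v', hv1, hv2, hv3⟩ := hC v fun i hi => hw i (List.mem_append_right _ hi)
      refine ⟨List.replicate a ⟨k, hk⟩ ++ u' ++ List.replicate b ⟨k, hk⟩ ++ v' ++
        List.replicate c ⟨k, hk⟩, ?_, ?_, ?_⟩
      · simp only [List.length_append, List.length_replicate] at hl ⊢
        omega
      · have h1 := blocks_append_le (List.replicate a ⟨k, hk⟩ ++ u' ++ List.replicate b ⟨k, hk⟩ ++ v')
          (List.replicate c ⟨k, hk⟩)
        have h2 := blocks_append_le (List.replicate a ⟨k, hk⟩ ++ u' ++ List.replicate b ⟨k, hk⟩) v'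
        have h3 := blocks_append_le (List.replicate a ⟨k, hk⟩ ++ u') (List.replicate b ⟨k, hk⟩)
        have h4 := blocks_append_le (List.replicate a ⟨k, hk⟩) u'
        have h5 := blocks_replicate_le a (⟨k, hk⟩ : Fin n)
        have h6 := blocks_replicate_le b (⟨k, hk⟩ : Fin n)
        have h7 := blocks_replicate_le c (⟨k, hk⟩ : Fin n)
        omega
      · rw [h, h']
        simp [hu3, hv3, mul_assoc]
    · obtain ⟨β, h1, h2, h3⟩ := hC α fun i _ => by omega
      exact ⟨β, h1, by omega, h3⟩

/-- If `x_i x_j = q x_j x_i` for `i < j` with a central element `q`, then every monomial in the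
`x_i` is equal to a monomial of the same degree with a bounded number of blocks. -/
theorem exists_prod_eq_of_blocks_le (hq : ∀ a, Commute q a)
    (hx : ∀ i j, i < j → x i * x j = q * (x j * x i)) :
    ∃ C : ℕ, ∀ α : List (Fin n), ∃ β : List (Fin n), β.length = α.length ∧ blocks β ≤ C ∧
        (β.map x).prod = (α.map x).prod := by
  obtain ⟨C, hC⟩ := exists_prod_eq_of_blocks_le_aux hq hx n
  exact ⟨C, fun α => hC α fun i _ => i.2⟩

end Commutation

/-! ### Monomial expansions -/

namespace NCSeries

theorem coeff_word (w v : List (Fin n)) : (word w).coeff v = if v = w then 1 else 0 := rfl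

@[simp] theorem coeff_sub (a b : NCSeries n) (w) : (a - b).coeff w = a.coeff w - b.coeff w := rfl

theorem word_mul_word (u v : List (Fin n)) : word u * word v = word (u ++ v) := by
  ext w
  simp only [coeff_mul, coeff_word]
  by_cases h : w = u ++ v
  · subst h
    rw [Finset.sum_eq_single u.length]
    · simp
    · intro i hi hiu
      have hi' : i ≤ (u ++ v).length := Nat.lt_succ_iff.1 (Finset.mem_range.1 hi)
      have : (u ++ v).take i ≠ u := fun h => hiu <| by
        have := congrArg List.length h
        rw [List.length_take, min_eq_left hi'] at this
        exact this
      simp [this]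
    · simp
  · rw [if_neg h]
    refine Finset.sum_eq_zero fun i _ => ?_
    by_cases h1 : w.take i = u
    · by_cases h2 : w.drop i = v
      · exact absurd (by rw [← h1, ← h2, List.take_append_drop]) h
      · simp [h2]
    · simp [h1]

end NCSeries

section WordAlgebra

variable (W : Set (Weight n))

theorem withSeminorms_wordSeminorm : WithSeminorms (wordSeminorm W) :=
  (SeminormFamily.withSeminorms_iff_topologicalSpace_eq_iInf _).2 rfl

theorem continuous_wordSeminorm (ω : W) : Continuous (wordSeminorm W ω) :=
  (withSeminorms_wordSeminorm W).continuous_seminorm ω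

theorem wordSeminorm_apply (ω : W) (a : WordAlgebra W) :
    wordSeminorm W ω a = ∑' w, ‖(a : NCSeries n).coeff w‖ * ω.1.toFun w := rfl

/-- The monomial `ζ_w` as an element of the algebra. -/
noncomputable def monomial (w : List (Fin n)) : WordAlgebra W :=
  ⟨NCSeries.word w, fun ω _ => summable_of_ne_finset_zero (s := {w}) fun v hv => by
    have : ¬ (v = w) := by simpa using hv
    simp [NCSeries.word, this]⟩

theorem coe_monomial (w : List (Fin n)) : (monomial W w : NCSeries n) = NCSeries.word w := rfl

theorem monomial_mul (u v : List (Fin n)) : monomial W u * monomial W v = monomial W (u ++ v) :=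
  Subtype.ext (NCSeries.word_mul_word u v)

theorem monomial_eq_prod (w : List (Fin n)) : monomial W w = (w.map (zeta W)).prod := by
  induction w with
  | nil => rfl
  | cons i w ih =>
    rw [List.map_cons, List.prod_cons, ← ih]
    exact (monomial_mul W [i] w).symm

theorem wordSeminorm_monomial (ω : W) (w : List (Fin n)) :
    wordSeminorm W ω (monomial W w) = ω.1.toFun w := by
  rw [wordSeminorm_apply, tsum_eq_single w]
  · simp [coe_monomial, NCSeries.coeff_word]
  · intro v hv
    simp [coe_monomial, NCSeries.coeff_word, hv]

theorem norm_coeff_mul_le (ω : W) (a : WordAlgebra W) (w : List (Fin n)) :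
    ‖(a : NCSeries n).coeff w‖ * ω.1.toFun w ≤ wordSeminorm W ω a :=
  (a.2 ω.1 ω.2).le_tsum w fun _ _ => mul_nonneg (norm_nonneg _) (ω.1.nonneg' _)

variable {W} in
/-- The coefficient at `w` as a continuous linear functional. -/
noncomputable def coeffCLM (w : List (Fin n)) (hw : ∃ ω : W, 0 < ω.1.toFun w) :
    WordAlgebra W →L[ℂ] ℂ where
  toFun a := (a : NCSeries n).coeff w
  map_add' _ _ := rfl
  map_smul' _ _ := rfl
  cont := by
    refine WithSeminorms.continuous_of_isBounded (withSeminorms_wordSeminorm W) (norm_withSeminorms ℂ ℂ)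
      (⟨⟨fun a : WordAlgebra W => (a : NCSeries n).coeff w, fun _ _ => rfl⟩, fun _ _ => rfl⟩ :
        WordAlgebra W →ₗ[ℂ] ℂ) fun _ => ?_
    obtain ⟨ω, hω⟩ := hw
    refine ⟨{ω}, ⟨(ω.1.toFun w)⁻¹, (inv_pos.2 hω).le⟩, fun a => ?_⟩
    have h := norm_coeff_mul_le W ω a w
    rw [← le_div_iff₀ hω, div_eq_inv_mul] at h
    rw [Finset.sup_singleton]
    exact h

/-- The part of a series supported on a finite set of words. -/
noncomputable def partialSum (s : Finset (List (Fin n))) (a : WordAlgebra W) : WordAlgebra W :=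
  ∑ w ∈ s, (a : NCSeries n).coeff w • monomial W w

theorem coeff_partialSum (s : Finset (List (Fin n))) (a : WordAlgebra W) (v : List (Fin n)) :
    (partialSum W s a : NCSeries n).coeff v = if v ∈ s then (a : NCSeries n).coeff v else 0 := by
  have : ∀ t : Finset (List (Fin n)), (partialSum W t a : NCSeries n).coeff v =
      ∑ w ∈ t, (a : NCSeries n).coeff w * if v = w then 1 else 0 := by
    intro t
    induction t using Finset.induction_on with
    | empty => rfl
    | insert w t hw ih =>
      rw [Finset.sum_insert hw, ← ih, partialSum, Finset.sum_insert hw]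
      rfl
  simp [this]

theorem partialSum_sub (s : Finset (List (Fin n))) (a b : WordAlgebra W) :
    partialSum W s (a - b) = partialSum W s a - partialSum W s b := by
  rw [partialSum, partialSum, partialSum, ← Finset.sum_sub_distrib]
  exact Finset.sum_congr rfl fun w _ => sub_smul _ _ _

theorem wordSeminorm_partialSum_le (ω : W) (s : Finset (List (Fin n))) (a : WordAlgebra W) :
    wordSeminorm W ω (partialSum W s a) ≤ wordSeminorm W ω a := by
  refine ((partialSum W s a).2 ω.1 ω.2).tsum_le_tsum (fun w => ?_) (a.2 ω.1 ω.2)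
  refine mul_le_mul_of_nonneg_right ?_ (ω.1.nonneg' w)
  rw [coeff_partialSum]
  split_ifs <;> simp

/-- In a weighted `ℓ¹` norm the norm of the tail is exactly the total norm minus the partial sum of
the norms. -/
theorem tendsto_wordSeminorm_partialSum_sub (ω : W) (a : WordAlgebra W) :
    Tendsto (fun s => wordSeminorm W ω (partialSum W s a - a)) atTop (𝓝 0) := by
  have ha := a.2 ω.1 ω.2
  have h := (tendsto_const_nhds (x := wordSeminorm W ω a)).sub ha.hasSum
  rw [← wordSeminorm_apply, sub_self] at h
  refine h.congr fun s => ?_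
  have hs : ∑ w ∈ s, ‖(a : NCSeries n).coeff w‖ * ω.1.toFun w =
      ∑' w, if w ∈ s then ‖(a : NCSeries n).coeff w‖ * ω.1.toFun w else 0 := by
    rw [tsum_eq_sum (s := s) fun w hw => by simp [hw]]
    exact Finset.sum_congr rfl fun w hw => by simp [hw]
  rw [hs, wordSeminorm_apply, wordSeminorm_apply,
    ← ha.tsum_sub (summable_of_ne_finset_zero (s := s) fun w hw => by simp [hw])]
  refine tsum_congr fun w => ?_
  have : ((partialSum W s a - a : WordAlgebra W) : NCSeries n).coeff w =
    (partialSum W s a : NCSeries n).coeff w - (a : NCSeries n).coeff w := rfl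
  rw [this, coeff_partialSum]
  split_ifs <;> simp

/-- Partial sums converge uniformly near every point. -/
theorem tendsto_partialSum_prod (a : WordAlgebra W) :
    Tendsto (fun p : Finset (List (Fin n)) × WordAlgebra W => partialSum W p.1 p.2)
      (atTop ×ˢ 𝓝 a) (𝓝 a) := by
  rw [(withSeminorms_wordSeminorm W).tendsto_nhds _ _]
  intro ω ε hε
  have h1 : Tendsto (fun b => wordSeminorm W ω (b - a)) (𝓝 a) (𝓝 0) := by
    have : Continuous fun b => wordSeminorm W ω (b - a) :=
      (continuous_wordSeminorm W ω).comp (continuous_id.sub continuous_const)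
    simpa using this.tendsto a
  have h2 := ((tendsto_wordSeminorm_partialSum_sub W ω a).comp tendsto_fst).add
    (h1.comp (tendsto_snd (f := (atTop : Filter (Finset (List (Fin n)))))))
  rw [add_zero] at h2
  filter_upwards [h2.eventually_lt_const hε] with p hp
  refine lt_of_le_of_lt ?_ hp
  -- Truncation error at the fixed point `a`, plus the truncation of a small perturbation.
  -- Truncation does not increase any seminorm, so the second term is small uniformly in the finite
  -- set.
  have : partialSum W p.1 p.2 - a =
      (partialSum W p.1 a - a) + partialSum W p.1 (p.2 - a) := by
    rw [partialSum_sub]; abel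
  rw [this]
  exact (map_add_le_add _ _ _).trans (add_le_add le_rfl (wordSeminorm_partialSum_le W ω _ _))

theorem hasSum_monomial (a : WordAlgebra W) :
    HasSum (fun w => (a : NCSeries n).coeff w • monomial W w) a := by
  have h : Tendsto (fun s : Finset (List (Fin n)) => (s, a)) atTop (atTop ×ˢ 𝓝 a) :=
    tendsto_id.prodMk tendsto_const_nhds
  have h' : Tendsto (fun s => partialSum W s a) atTop (𝓝 a) := by
    have := tendsto_partialSum_prod W a
    generalize partialSum W = P at this ⊢
    exact this.comp h
  rw [HasSum, SummationFilter.unconditional_filter]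
  exact h'

end WordAlgebra

/-! ### Monomial expansions of holomorphic functions -/

namespace Hol

variable {A B : Type*} [Ring A] [Algebra ℂ A] [TopologicalSpace A] [IsTopologicalRing A]
  [ContinuousSMul ℂ A] [Ring B] [Algebra ℂ B] [TopologicalSpace B] [IsTopologicalRing B]
  [ContinuousSMul ℂ B]

/-- Postcomposition with a continuous linear map. -/
noncomputable def mapCLM (L : A →L[ℂ] B) : Hol A →+ Hol B where
  toFun f := mk (fun z => L (f z)) (L.continuous.comp f.continuous_coe) fun z => by
    obtain ⟨D, hD⟩ := f.isHolomorphic z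
    refine ⟨L D, ((L.continuous.tendsto D).comp hD).congr fun w => ?_⟩
    simp [map_sub]
  map_zero' := Hol.ext fun _ => map_zero L
  map_add' _ _ := Hol.ext fun _ => map_add L _ _

@[simp] theorem mapCLM_apply (L : A →L[ℂ] B) (f : Hol A) (z : CStar) : mapCLM L f z = L (f z) := rfl

theorem continuous_mapCLM (L : A →L[ℂ] B) : Continuous (mapCLM L) :=
  Continuous.subtype_mk ((ContinuousMap.continuous_postcomp (⟨L, L.continuous⟩ : C(A, B))).comp
    continuous_subtype_val) _

theorem const_mul (a b : A) : const (a * b) = const a * const b := rfl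

theorem const_one : const (1 : A) = 1 := rfl

theorem continuous_const' : Continuous (const : A → Hol A) :=
  Continuous.subtype_mk ContinuousMap.continuous_const' _

/-- Continuous convergence implies convergence in the compact-open topology. -/
theorem tendsto_of_forall_tendsto_prod {ι : Type*} {l : Filter ι} {F : ι → Hol A} {f : Hol A}
    (h : ∀ z, Tendsto (fun p : ι × CStar => F p.1 p.2) (l ×ˢ 𝓝 z) (𝓝 (f z))) :
    Tendsto F l (𝓝 f) := by
  refine tendsto_subtype_rng.2 (ContinuousMap.tendsto_nhds_compactOpen.2 fun K hK U hU hf => ?_)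
  -- Compactness of `K` glues the local statements at its points into one that is uniform over a
  -- neighbourhood of `K`.
  have h1 : ∀ᶠ p : ι × CStar in l ×ˢ 𝓝ˢ K, F p.1 p.2 ∈ U := by
    rw [hK.prod_nhdsSet_eq_biSup, eventually_iSup]
    intro z
    rw [eventually_iSup]
    intro hz
    exact (h z).eventually (hU.mem_nhds (hf hz))
  filter_upwards [h1.curry] with i hi z hz
  exact (Filter.Eventually.self_of_nhdsSet hi) z hz

end Hol

section HolWordAlgebra

variable {W : Set (Weight n)}

/-- The coefficients of a holomorphic function with values in an algebra of series. -/
noncomputable def holCoeff (hW : ∀ w, ∃ ω : W, 0 < ω.1.toFun w) (w : List (Fin n))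
    (f : Hol (WordAlgebra W)) : Hol ℂ :=
  Hol.mapCLM (coeffCLM w (hW w)) f

variable (W) in
/-- The monomial `ζ_w` as a constant function. -/
noncomputable def holMonomial (w : List (Fin n)) : Hol (WordAlgebra W) := Hol.const (monomial W w)

theorem holMonomial_mul (u v : List (Fin n)) :
    holMonomial W u * holMonomial W v = holMonomial W (u ++ v) := by
  rw [holMonomial, holMonomial, ← Hol.const_mul, monomial_mul]
  rfl

/-- At each point the partial sums are the truncations of the value of `f`. Truncation converges
jointly in the finite set and the series (`tendsto_partialSum_prod`), so continuity of `f` gives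
convergence in the compact-open topology. -/
theorem hol_hasSum (hW : ∀ w, ∃ ω : W, 0 < ω.1.toFun w) (f : Hol (WordAlgebra W)) :
    HasSum (fun w => holCoeff hW w f • holMonomial W w) f := by
  rw [HasSum, SummationFilter.unconditional_filter]
  refine Hol.tendsto_of_forall_tendsto_prod fun z => ?_
  have h1 : Tendsto (fun p : Finset (List (Fin n)) × CStar => (p.1, f p.2)) (atTop ×ˢ 𝓝 z)
      (atTop ×ˢ 𝓝 (f z)) :=
    tendsto_id.prodMap (f.continuous_coe.tendsto z)
  have h2 : ∀ p : Finset (List (Fin n)) × CStar,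
      (∑ w ∈ p.1, holCoeff hW w f • holMonomial W w) p.2 = partialSum W p.1 (f p.2) := by
    rintro ⟨s, y⟩
    simp only [partialSum]
    induction s using Finset.induction_on with
    | empty => rfl
    | insert w s hw ih =>
      rw [Finset.sum_insert hw, Finset.sum_insert hw, ← ih, Hol.add_apply, Hol.smul_apply]
      rfl
  have h3 := tendsto_partialSum_prod W (f z)
  simp_rw [h2]
  generalize partialSum W = P at h3 ⊢
  exact h3.comp h1

/-! ### Monomials in the deformation algebra -/

theorem defMk_holMonomial (w : List (Fin n)) :
    defMk W (holMonomial W w) = (w.map (defGen W)).prod := by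
  rw [holMonomial, monomial_eq_prod]
  induction w with
  | nil => rw [List.map_nil, List.map_nil, List.prod_nil, List.prod_nil, Hol.const_one, map_one]
  | cons i w ih =>
    rw [List.map_cons, List.map_cons, List.prod_cons, List.prod_cons, Hol.const_mul, map_mul, ih]
    rfl

theorem defMk_eq_zero_iff {f : Hol (WordAlgebra W)} : defMk W f = 0 ↔ f ∈ defIdeal W :=
  Ideal.Quotient.eq_zero_iff_mem

theorem defMk_surjective : Function.Surjective (defMk W) :=
  Ideal.Quotient.mk_surjective

theorem defGen_mul_defGen {i j : Fin n} (hij : i < j) :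
    defGen W i * defGen W j =
      algebraMap (Hol ℂ) (DefAlgebra W) Hol.coord * (defGen W j * defGen W i) := by
  have h : defMk W (relation W i j) = 0 :=
    defMk_eq_zero_iff.2 (subset_closedTwoSidedIdeal _ ⟨i, j, hij, rfl⟩)
  rw [relation, map_sub, map_smul, map_mul, map_mul, sub_eq_zero] at h
  rw [← Algebra.smul_def]
  exact h

/-- Modulo the defining relations, every monomial is equal to a monomial of the same degree with a
bounded number of blocks. -/
theorem exists_blocks_le_defGen (W : Set (Weight n)) :
    ∃ (C : ℕ) (β : List (Fin n) → List (Fin n)), (∀ α, (β α).length = α.length) ∧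
      (∀ α, blocks (β α) ≤ C) ∧
      ∀ α, ((β α).map (defGen W)).prod = (α.map (defGen W)).prod := by
  obtain ⟨C, hC⟩ := exists_prod_eq_of_blocks_le (x := defGen W)
    (q := algebraMap (Hol ℂ) (DefAlgebra W) Hol.coord)
    (fun a => Algebra.commutes _ a) fun i j hij => defGen_mul_defGen hij
  choose β h1 h2 h3 using hC
  exact ⟨C, β, h1, h2, h3⟩

/-- The ideal of relations contains the sum of a series if it contains all its terms. -/
theorem HasSum.mem_defIdeal {ι : Type*} {f : ι → Hol (WordAlgebra W)} {g : Hol (WordAlgebra W)}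
    (h : HasSum f g) (hf : ∀ i, f i ∈ defIdeal W) : g ∈ defIdeal W := by
  have hc : IsClosed (defIdeal W : Set (Hol (WordAlgebra W))) := isClosed_closedTwoSidedIdeal _
  rw [HasSum, SummationFilter.unconditional_filter] at h
  exact hc.mem_of_tendsto h (Eventually.of_forall fun s => Submodule.sum_mem _ fun i _ => hf i)

end HolWordAlgebra

/-! ### Relabelling of monomials -/

section Relabel

variable {W W' : Set (Weight n)}

theorem finite_fiber {β : List (Fin n) → List (Fin n)} (hβ : ∀ α, (β α).length = α.length)
    (w : List (Fin n)) : Finite {u // β u = w} := by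
  refine ((List.finite_length_eq (Fin n) w.length).subset ?_).to_subtype
  rintro u rfl
  exact (hβ u).symm

/-- Resummation over the fibres of `β`: the triangle inequality in each finite fibre, then the
weight comparison `hK`. -/
theorem summable_fiber_sum_and_tsum_le {β : List (Fin n) → List (Fin n)}
    (hβ : ∀ α, (β α).length = α.length) {ω ω' : Weight n} {K : ℝ}
    (hK : ∀ α, ω'.toFun (β α) ≤ K * ω.toFun α) {c : List (Fin n) → ℂ}
    (hc : Summable fun w => ‖c w‖ * ω.toFun w) :
    (Summable fun w => ‖∑' u : {u // β u = w}, c u‖ * ω'.toFun w) ∧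
      ∑' w, ‖∑' u : {u // β u = w}, c u‖ * ω'.toFun w ≤ K * ∑' w, ‖c w‖ * ω.toFun w := by
  have hle : ∀ u, ‖c u‖ * ω'.toFun (β u) ≤ K * (‖c u‖ * ω.toFun u) := fun u =>
    (mul_le_mul_of_nonneg_left (hK u) (norm_nonneg _)).trans_eq (by ring)
  have hg : Summable fun u => ‖c u‖ * ω'.toFun (β u) :=
    Summable.of_nonneg_of_le (fun u => mul_nonneg (norm_nonneg _) (ω'.nonneg' _)) hle
      (hc.mul_left K)
  have hS := (Equiv.sigmaFiberEquiv β).summable_iff.2 hg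
  have hle' : ∀ w, ‖∑' u : {u // β u = w}, c u‖ * ω'.toFun w ≤
      ∑' u : {u // β u = w}, ‖c u‖ * ω'.toFun (β u) := by
    intro w
    have := finite_fiber hβ w
    have := Fintype.ofFinite {u // β u = w}
    rw [tsum_fintype, tsum_fintype]
    refine (mul_le_mul_of_nonneg_right (norm_sum_le _ _) (ω'.nonneg' w)).trans ?_
    rw [Finset.sum_mul]
    exact Finset.sum_le_sum fun u _ => by rw [u.2]
  have hs := Summable.of_nonneg_of_le (fun w => mul_nonneg (norm_nonneg _) (ω'.nonneg' w)) hle'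
    hS.sigma
  refine ⟨hs, (hs.tsum_le_tsum hle' hS.sigma).trans ?_⟩
  rw [← tsum_mul_left]
  exact (hS.tsum_sigma.symm.trans ((Equiv.sigmaFiberEquiv β).tsum_eq
    fun u => ‖c u‖ * ω'.toFun (β u))).trans_le
    (hg.tsum_le_tsum hle (hc.mul_left K))

/-- The linear map `∑ c_α ζ_α ↦ ∑ c_α ζ_{β(α)}`. -/
noncomputable def relabelLinear (β : List (Fin n) → List (Fin n))
    (hβ : ∀ α, (β α).length = α.length)
    (h : ∀ ω' ∈ W', ∃ ω ∈ W, ∃ K : ℝ≥0, ∀ α, ω'.toFun (β α) ≤ K * ω.toFun α) :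
    WordAlgebra W →ₗ[ℂ] WordAlgebra W' where
  toFun a := ⟨⟨fun w => ∑' u : {u // β u = w}, (a : NCSeries n).coeff u⟩, fun ω' hω' => by
    obtain ⟨ω, hω, K, hK⟩ := h ω' hω'
    exact (summable_fiber_sum_and_tsum_le hβ hK (a.2 ω hω)).1⟩
  map_add' a b := by
    refine Subtype.ext (NCSeries.ext (funext fun w => ?_))
    have := finite_fiber hβ w
    exact Summable.tsum_add (.of_finite) (.of_finite)
  map_smul' c a := Subtype.ext (NCSeries.ext (funext fun w => tsum_mul_left))

/-- The continuous linear map `∑ c_α ζ_α ↦ ∑ c_α ζ_{β(α)}`. -/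
noncomputable def relabel (β : List (Fin n) → List (Fin n)) (hβ : ∀ α, (β α).length = α.length)
    (h : ∀ ω' ∈ W', ∃ ω ∈ W, ∃ K : ℝ≥0, ∀ α, ω'.toFun (β α) ≤ K * ω.toFun α) :
    WordAlgebra W →L[ℂ] WordAlgebra W' where
  toLinearMap := relabelLinear β hβ h
  cont := by
    refine WithSeminorms.continuous_of_isBounded (withSeminorms_wordSeminorm W)
      (withSeminorms_wordSeminorm W') (relabelLinear β hβ h) fun ω' => ?_
    obtain ⟨ω, hω, K, hK⟩ := h ω'.1 ω'.2
    refine ⟨{⟨ω, hω⟩}, K, fun a => ?_⟩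
    rw [Finset.sup_singleton]
    exact (summable_fiber_sum_and_tsum_le hβ hK (a.2 ω hω)).2

theorem relabel_monomial (β : List (Fin n) → List (Fin n)) (hβ : ∀ α, (β α).length = α.length)
    (h : ∀ ω' ∈ W', ∃ ω ∈ W, ∃ K : ℝ≥0, ∀ α, ω'.toFun (β α) ≤ K * ω.toFun α)
    (w : List (Fin n)) : relabel β hβ h (monomial W w) = monomial W' (β w) := by
  refine Subtype.ext (NCSeries.ext (funext fun v => ?_))
  change ∑' u : {u // β u = v}, (if (u : List (Fin n)) = w then (1 : ℂ) else 0) =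
    if v = β w then 1 else 0
  by_cases hv : β w = v
  · rw [tsum_eq_single ⟨w, hv⟩ fun u hu => if_neg fun h => hu (Subtype.ext h), if_pos rfl,
      if_pos hv.symm]
  · rw [if_neg (Ne.symm hv)]
    convert tsum_zero with u
    refine if_neg fun hu => hv ?_
    rw [← hu, u.2]

/-- Relabelling of monomials in the coefficients of holomorphic functions. -/
noncomputable def holRelabel (β : List (Fin n) → List (Fin n)) (hβ : ∀ α, (β α).length = α.length)
    (h : ∀ ω' ∈ W', ∃ ω ∈ W, ∃ K : ℝ≥0, ∀ α, ω'.toFun (β α) ≤ K * ω.toFun α) :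
    Hol (WordAlgebra W) →+ Hol (WordAlgebra W') :=
  Hol.mapCLM (relabel β hβ h)

variable {β : List (Fin n) → List (Fin n)} (hβ : ∀ α, (β α).length = α.length)
    (h : ∀ ω' ∈ W', ∃ ω ∈ W, ∃ K : ℝ≥0, ∀ α, ω'.toFun (β α) ≤ K * ω.toFun α)

theorem continuous_holRelabel : Continuous (holRelabel β hβ h) := Hol.continuous_mapCLM _

theorem holRelabel_smul (c : Hol ℂ) (f : Hol (WordAlgebra W)) :
    holRelabel β hβ h (c • f) = c • holRelabel β hβ h f := by
  refine Hol.ext fun z => ?_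
  rw [Hol.smul_apply, holRelabel, Hol.mapCLM_apply, Hol.smul_apply, map_smul]
  rfl

theorem holRelabel_holMonomial (w : List (Fin n)) :
    holRelabel β hβ h (holMonomial W w) = holMonomial W' (β w) :=
  Hol.ext fun _ => relabel_monomial β hβ h w

theorem holMonomial_sub_mem (hβ' : ∀ α, ((β α).map (defGen W)).prod = (α.map (defGen W)).prod)
    (w : List (Fin n)) : holMonomial W (β w) - holMonomial W w ∈ defIdeal W := by
  rw [← defMk_eq_zero_iff, map_sub, defMk_holMonomial, defMk_holMonomial, hβ', sub_self]

theorem defMk_holRelabel_holMonomial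
    (hβ' : ∀ α, ((β α).map (defGen W')).prod = (α.map (defGen W')).prod) (w : List (Fin n)) :
    defMk W' (holRelabel β hβ h (holMonomial W w)) = (w.map (defGen W')).prod := by
  rw [holRelabel_holMonomial, defMk_holMonomial, hβ']

/-- On monomials both sides are the class of the concatenated word, since `β` does not change
classes. Both sides are additive and continuous in each factor and compatible with scalars from `Hol
ℂ`, so monomial expansions and closedness of the ideal give the general case. -/
theorem defMk_holRelabel_mul (hW : ∀ w, ∃ ω : W, 0 < ω.1.toFun w)
    (hβ' : ∀ α, ((β α).map (defGen W')).prod = (α.map (defGen W')).prod)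
    (f g : Hol (WordAlgebra W)) :
    defMk W' (holRelabel β hβ h (f * g)) =
      defMk W' (holRelabel β hβ h f) * defMk W' (holRelabel β hβ h g) := by
  let Φ : Hol (WordAlgebra W) → Hol (WordAlgebra W) → Hol (WordAlgebra W') := fun f g =>
    holRelabel β hβ h (f * g) - holRelabel β hβ h f * holRelabel β hβ h g
  have hsub : ∀ f g, Φ f g ∈ defIdeal W' ↔ defMk W' (holRelabel β hβ h (f * g)) =
      defMk W' (holRelabel β hβ h f) * defMk W' (holRelabel β hβ h g) := fun f g => by
    rw [← defMk_eq_zero_iff, map_sub, map_mul (defMk W') (holRelabel β hβ h f), sub_eq_zero]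
  have hT := continuous_holRelabel hβ h
  have h1 : ∀ (u : List (Fin n)) (g : Hol (WordAlgebra W)), Φ (holMonomial W u) g ∈ defIdeal W' := by
    intro u g
    have hs := hol_hasSum hW g
    have hs' := (hs.mul_left (holMonomial W u)).map (holRelabel β hβ h) hT |>.sub
      ((hs.map (holRelabel β hβ h) hT).mul_left (holRelabel β hβ h (holMonomial W u)))
    refine HasSum.mem_defIdeal hs' fun v => ?_
    rw [← defMk_eq_zero_iff]
    simp only [Function.comp_apply, mul_smul_comm, holRelabel_smul, map_sub, map_smul, map_mul,
      holMonomial_mul]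
    rw [defMk_holRelabel_holMonomial hβ h hβ', defMk_holRelabel_holMonomial hβ h hβ',
      defMk_holRelabel_holMonomial hβ h hβ', List.map_append, List.prod_append, sub_self]
  rw [← hsub]
  have hs := hol_hasSum hW f
  have hs' := (hs.mul_right g).map (holRelabel β hβ h) hT |>.sub
    ((hs.map (holRelabel β hβ h) hT).mul_right (holRelabel β hβ h g))
  refine HasSum.mem_defIdeal hs' fun u => ?_
  rw [← defMk_eq_zero_iff]
  simp only [Function.comp_apply, smul_mul_assoc, holRelabel_smul, map_sub, map_smul, map_mul]
  rw [(hsub _ _).1 (h1 u g), sub_self]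

/-- Relabelling maps one ideal of relations to the other. -/
theorem holRelabel_mem_defIdeal (hW : ∀ w, ∃ ω : W, 0 < ω.1.toFun w)
    (hβ' : ∀ α, ((β α).map (defGen W')).prod = (α.map (defGen W')).prod)
    {f : Hol (WordAlgebra W)} (hf : f ∈ defIdeal W) : holRelabel β hβ h f ∈ defIdeal W' := by
  have hmul := defMk_holRelabel_mul hβ h hW hβ'
  -- The preimage of the target ideal is an ideal only thanks to multiplicativity modulo that ideal.
  -- It is closed and contains the relations, so it contains `defIdeal W`.
  let J : Ideal (Hol (WordAlgebra W)) :=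
    { carrier := {f | holRelabel β hβ h f ∈ defIdeal W'}
      add_mem' := fun {a b} ha hb => by
        rw [Set.mem_ofPred_eq, map_add]; exact add_mem ha hb
      zero_mem' := by rw [Set.mem_ofPred_eq, map_zero]; exact zero_mem _
      smul_mem' := fun c a ha => by
        rw [Set.mem_ofPred_eq, ← defMk_eq_zero_iff] at ha ⊢
        rw [smul_eq_mul, hmul, ha, mul_zero] }
  have hJ : defIdeal W ≤ J := by
    refine closedTwoSidedIdeal_le ⟨fun {a} b ha => ?_⟩ ?_ ?_
    · change holRelabel β hβ h (a * b) ∈ defIdeal W'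
      replace ha : holRelabel β hβ h a ∈ defIdeal W' := ha
      rw [← defMk_eq_zero_iff] at ha ⊢
      rw [hmul, ha, zero_mul]
    · exact (isClosed_closedTwoSidedIdeal _).preimage (continuous_holRelabel hβ h)
    · rintro _ ⟨i, j, hij, rfl⟩
      change holRelabel β hβ h (holMonomial W [i] * holMonomial W [j]
        - Hol.coord • (holMonomial W [j] * holMonomial W [i])) ∈ defIdeal W'
      rw [holMonomial_mul, holMonomial_mul, ← defMk_eq_zero_iff, map_sub, map_sub, holRelabel_smul,
        map_smul, defMk_holRelabel_holMonomial hβ h hβ', defMk_holRelabel_holMonomial hβ h hβ',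
        sub_eq_zero]
      simpa [Algebra.smul_def] using defGen_mul_defGen hij
  exact hJ hf

end Relabel

/-! ### The isomorphism criterion -/

section Isomorphism

variable {W W' : Set (Weight n)}

theorem holInclusion_holMonomial (hsub : W' ⊆ W) (w : List (Fin n)) :
    holInclusion hsub (holMonomial W w) = holMonomial W' w := rfl

/-- If the classes of all monomials in the deformation algebra for `W` are controlled by the weights
from `W' ⊆ W`, then the deformation algebras for `W` and `W'` are isomorphic. -/
theorem exists_defMap_equiv (hsub : W' ⊆ W) (hW : ∀ w, ∃ ω : W, 0 < ω.1.toFun w)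
    (hW' : ∀ w, ∃ ω : W', 0 < ω.1.toFun w) {β : List (Fin n) → List (Fin n)}
    (hβ : ∀ α, (β α).length = α.length)
    (h : ∀ ω' ∈ W, ∃ ω ∈ W', ∃ K : ℝ≥0, ∀ α, ω'.toFun (β α) ≤ K * ω.toFun α)
    (hβ' : ∀ α, ((β α).map (defGen W)).prod = (α.map (defGen W)).prod) :
    ∃ e : DefAlgebra W ≃A[Hol ℂ] DefAlgebra W', ∀ x, e x = defMap hsub x := by
  have hT := continuous_holRelabel hβ h
  have left_inv : ∀ f : Hol (WordAlgebra W),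
      holRelabel β hβ h (holInclusion hsub f) - f ∈ defIdeal W := by
    intro f
    have hs := hol_hasSum hW f
    have hs' := ((hs.map (holInclusion hsub) (continuous_holInclusion hsub)).map
      (holRelabel β hβ h) hT).sub hs
    refine HasSum.mem_defIdeal hs' fun w => ?_
    simp only [Function.comp_apply, map_smul, holRelabel_smul]
    rw [holInclusion_holMonomial, holRelabel_holMonomial, ← smul_sub, Algebra.smul_def]
    exact Ideal.mul_mem_left _ _ (holMonomial_sub_mem hβ' w)
  have right_inv : ∀ f : Hol (WordAlgebra W'),
      holInclusion hsub (holRelabel β hβ h f) - f ∈ defIdeal W' := by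
    intro f
    have hs := hol_hasSum hW' f
    have hs' := ((hs.map (holRelabel β hβ h) hT).map (holInclusion hsub)
      (continuous_holInclusion hsub)).sub hs
    refine HasSum.mem_defIdeal hs' fun w => ?_
    simp only [Function.comp_apply, map_smul, holRelabel_smul]
    rw [holRelabel_holMonomial, ← smul_sub, Algebra.smul_def, ← holInclusion_holMonomial hsub w,
      ← map_sub]
    exact Ideal.mul_mem_left _ _ (defIdeal_le_comap hsub (holMonomial_sub_mem hβ' w))
  have hinj : Function.Injective (defMap hsub) := by
    rw [injective_iff_map_eq_zero]
    intro x hx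
    obtain ⟨f, rfl⟩ := defMk_surjective x
    rw [defMap_defMk, defMk_eq_zero_iff] at hx
    rw [defMk_eq_zero_iff]
    -- Relabelling sends the image of `f` back into `defIdeal W`, and the result differs from `f` by
    -- an element of that ideal.
    have h1 := holRelabel_mem_defIdeal hβ h hW' hβ' hx
    simpa using sub_mem h1 (left_inv f)
  have hinv : ∀ f, defMap hsub (defMk W (holRelabel β hβ h f)) = defMk W' f := by
    intro f
    rw [defMap_defMk, ← sub_eq_zero, ← map_sub, defMk_eq_zero_iff]
    exact right_inv f
  have hsurj : Function.Surjective (defMap hsub) := by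
    intro y
    obtain ⟨f, rfl⟩ := defMk_surjective y
    exact ⟨_, hinv f⟩
  let e : DefAlgebra W ≃ₐ[Hol ℂ] DefAlgebra W' :=
    AlgEquiv.ofBijective (defMap hsub : DefAlgebra W →ₐ[Hol ℂ] DefAlgebra W') ⟨hinj, hsurj⟩
  refine ⟨{ e with
    continuous_toFun := (defMap hsub).continuous
    continuous_invFun := ?_ }, fun x => rfl⟩
  change Continuous e.symm
  refine continuous_coinduced_dom.2 ?_
  -- The inverse lifts to the continuous relabelling, so it is continuous for the quotient topology.
  have : e.symm ∘ defMk W' = defMk W ∘ holRelabel β hβ h := by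
    funext f
    refine e.symm_apply_eq.2 (hinv f).symm
  rw [this]
  exact continuous_coinduced_rng.comp hT

end Isomorphism

/-! ### Directed families of weights -/

section Directed

variable {W : Set (Weight n)}

/-- A continuous seminorm is bounded on monomials by one of the weights of a directed family. -/
theorem exists_weight_bound [Nonempty W] (hdir : Directed (· ≤ ·) fun ω : W => ω.1.toFun)
    (q : Seminorm ℂ (WordAlgebra W)) (hq : Continuous q) :
    ∃ (ω : W) (K : ℝ), 0 < K ∧ ∀ w, q (monomial W w) ≤ K * ω.1.toFun w := by
  obtain ⟨s, K, hK, h⟩ := Seminorm.bound_of_continuous (withSeminorms_wordSeminorm W) q hq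
  obtain ⟨ω, hω⟩ := hdir.finset_le s
  refine ⟨ω, K, by positivity, fun w => (h _).trans ?_⟩
  refine mul_le_mul_of_nonneg_left ?_ K.2
  refine Seminorm.finset_sup_apply_le (ω.1.nonneg' w) fun i hi => ?_
  rw [wordSeminorm_monomial]
  exact hω i hi w

end Directed

theorem exists_ofReal_lt {r : ℝ≥0∞} (hr : 0 < r) : ∃ ρ : ℝ, 0 < ρ ∧ ENNReal.ofReal ρ < r := by
  obtain ⟨ρ, h0, h1⟩ := ENNReal.lt_iff_exists_nnreal_btwn.1 hr
  exact ⟨ρ, by exact_mod_cast h0, by simpa using h1⟩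

theorem directed_polydiskWeights (n : ℕ) (r : ℝ≥0∞) :
    Directed (· ≤ ·) fun ω : polydiskWeights n r => ω.1.toFun := by
  rintro ⟨_, ρ, τ, hρ, hτ, hr, rfl⟩ ⟨_, ρ', τ', hρ', hτ', hr', rfl⟩
  refine ⟨⟨_, max ρ ρ', max τ τ', lt_max_of_lt_left hρ, le_max_of_le_left hτ, ?_, rfl⟩,
    fun w => ?_, fun w => ?_⟩
  · rcases max_choice ρ ρ' with h | h <;> rw [h] <;> assumption
  · change ρ ^ w.length * τ ^ blocks w ≤ max ρ ρ' ^ w.length * max τ τ' ^ blocks w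
    gcongr <;> exact le_max_left _ _
  · change ρ' ^ w.length * τ' ^ blocks w ≤ max ρ ρ' ^ w.length * max τ τ' ^ blocks w
    gcongr <;> exact le_max_right _ _

theorem directed_taylorWeights (n : ℕ) (r : ℝ≥0∞) :
    Directed (· ≤ ·) fun ω : taylorWeights n r => ω.1.toFun := by
  rintro ⟨_, ρ, hρ, hr, rfl⟩ ⟨_, ρ', hρ', hr', rfl⟩
  refine ⟨⟨_, max ρ ρ', lt_max_of_lt_left hρ, ?_, rfl⟩, fun w => ?_, fun w => ?_⟩
  · rcases max_choice ρ ρ' with h | h <;> rw [h] <;> assumption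
  · change ρ ^ w.length ≤ max ρ ρ' ^ w.length
    gcongr; exact le_max_left _ _
  · change ρ' ^ w.length ≤ max ρ ρ' ^ w.length
    gcongr; exact le_max_right _ _

theorem nonempty_taylorWeights (n : ℕ) {r : ℝ≥0∞} (hr : 0 < r) : Nonempty (taylorWeights n r) :=
  let ⟨ρ, hρ, h⟩ := exists_ofReal_lt hr
  ⟨⟨_, ρ, hρ, h, rfl⟩⟩

theorem nonempty_polydiskWeights (n : ℕ) {r : ℝ≥0∞} (hr : 0 < r) :
    Nonempty (polydiskWeights n r) :=
  (nonempty_taylorWeights n hr).map fun ω => ⟨ω.1, taylorWeights_subset n r ω.2⟩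

theorem exists_polydiskWeight_pos {r : ℝ≥0∞} (hr : 0 < r) (w : List (Fin n)) :
    ∃ ω : polydiskWeights n r, 0 < ω.1.toFun w := by
  obtain ⟨ω, ρ, τ, hρ, hτ, h, rfl⟩ := nonempty_polydiskWeights n hr
  exact ⟨⟨_, ρ, τ, hρ, hτ, h, rfl⟩, mul_pos (pow_pos hρ _) (pow_pos (zero_lt_one.trans_le hτ) _)⟩

theorem exists_taylorWeight_pos {r : ℝ≥0∞} (hr : 0 < r) (w : List (Fin n)) :
    ∃ ω : taylorWeights n r, 0 < ω.1.toFun w := by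
  obtain ⟨ω, ρ, hρ, h, rfl⟩ := nonempty_taylorWeights n hr
  exact ⟨⟨_, ρ, hρ, h, rfl⟩, pow_pos hρ _⟩

/-- The canonical homomorphism is a topological isomorphism. -/
theorem exists_iDD_equiv (n : ℕ) {r : ℝ≥0∞} (hr : 0 < r) :
    ∃ e : ODef n r ≃A[Hol ℂ] ODefT n r, ∀ x, e x = iDD n r x := by
  obtain ⟨C, β, hβ, hC, hβ'⟩ := exists_blocks_le_defGen (polydiskWeights n r)
  refine exists_defMap_equiv (taylorWeights_subset n r) (exists_polydiskWeight_pos hr)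
    (exists_taylorWeight_pos hr) hβ ?_ hβ'
  rintro _ ⟨ρ, τ, hρ, hτ, h, rfl⟩
  refine ⟨_, ⟨ρ, hρ, h, rfl⟩, ⟨τ ^ C, by positivity⟩, fun α => ?_⟩
  change ρ ^ (β α).length * τ ^ blocks (β α) ≤ τ ^ C * ρ ^ α.length
  rw [hβ, mul_comm]
  gcongr
  exact hC α

/-! ### Contractivity -/

/-- The strict inequality comes for free: the radius `ρ` of any single weight dominating `φ` on
monomials is already below `r`. -/
theorem isStrictlySpectrallyContractive_defGen (n : ℕ) {r : ℝ≥0∞} (hr : 0 < r) :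
    IsStrictlySpectrallyContractive.{u} r (defGen (polydiskWeights n r)) := by
  intro B _ _ _ φ
  obtain ⟨C, β, hβ, hC, hβ'⟩ := exists_blocks_le_defGen (polydiskWeights n r)
  have := nonempty_polydiskWeights n hr
  let q : Seminorm ℂ (FreePolydisk n r) := Seminorm.of
    (fun a => ‖φ (defMk (polydiskWeights n r) (Hol.const a))‖)
    (fun a b => by
      rw [show Hol.const (a + b) = Hol.const a + Hol.const b from rfl, map_add, map_add]
      exact norm_add_le _ _)
    (fun c a => by
      rw [← norm_smul, ← map_smul]
      rfl)
  have hq : Continuous q :=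
    (φ.continuous.comp (continuous_coinduced_rng.comp Hol.continuous_const')).norm
  obtain ⟨⟨_, ρ, τ, hρ, hτ, h, rfl⟩, K, hK, hb⟩ :=
    exists_weight_bound (directed_polydiskWeights n r) q hq
  have hbound : ∀ w : List (Fin n),
      ‖(w.map fun i => φ (defGen (polydiskWeights n r) i)).prod‖ ≤ K * τ ^ C * ρ ^ w.length := by
    intro w
    have h1 : (w.map fun i => φ (defGen (polydiskWeights n r) i)).prod =
        φ (defMk _ (Hol.const (monomial _ (β w)))) := by
      rw [← holMonomial, defMk_holMonomial, hβ', map_list_prod, List.map_map]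
      rfl
    rw [h1]
    refine (hb (β w)).trans ?_
    change K * (ρ ^ (β w).length * τ ^ blocks (β w)) ≤ _
    rw [hβ, mul_assoc, mul_comm (τ ^ C)]
    gcongr
    exact hC w
  -- The constant `K * τ ^ C` does not depend on the degree, so its `d`-th root tends to `1`.
  have hpos : 0 < K * τ ^ C := by positivity
  have hlim : Tendsto (fun d : ℕ => ENNReal.ofReal ((K * τ ^ C) ^ ((1 : ℝ) / d) * ρ)) atTop
      (𝓝 (ENNReal.ofReal ρ)) := by
    refine ENNReal.tendsto_ofReal ?_
    have h1 : Tendsto (fun d : ℕ => (K * τ ^ C) ^ ((1 : ℝ) / d)) atTop (𝓝 ((K * τ ^ C) ^ (0 : ℝ))) :=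
      (Real.continuousAt_const_rpow hpos.ne').tendsto.comp tendsto_one_div_atTop_nhds_zero_nat
    simpa using h1.mul_const ρ
  refine lt_of_le_of_lt ?_ h
  rw [← hlim.limsup_eq]
  refine limsup_le_limsup ?_
  filter_upwards [eventually_gt_atTop 0] with d hd
  have hd' : (d : ℝ) ≠ 0 := by exact_mod_cast hd.ne'
  have h2 : (K * τ ^ C) ^ ((1 : ℝ) / d) * ρ = (K * τ ^ C * ρ ^ d) ^ ((1 : ℝ) / d) := by
    rw [Real.mul_rpow hpos.le (by positivity), ← Real.rpow_natCast ρ, ← Real.rpow_mul hρ.le,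
      mul_one_div_cancel hd', Real.rpow_one]
  rw [h2, ← ENNReal.ofReal_rpow_of_nonneg (by positivity) (by positivity)]
  refine ENNReal.rpow_le_rpow (iSup_le fun α => ?_) (by positivity)
  rw [← ofReal_norm]
  refine ENNReal.ofReal_le_ofReal ?_
  have h3 := hbound (List.ofFn α)
  rw [List.map_ofFn, List.length_ofFn] at h3
  exact h3

/-! ### The underlying topological vector spaces -/

/-- The word `i j i j …` of length `d`. -/
def alternating (i j : Fin n) : ℕ → List (Fin n)
  | 0 => []
  | d + 1 => i :: alternating j i d

theorem length_alternating (i j : Fin n) (d : ℕ) : (alternating i j d).length = d := by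
  induction d generalizing i j with
  | zero => rfl
  | succ d ih => simp [alternating, ih]

theorem blocks_alternating {i j : Fin n} (hij : i ≠ j) (d : ℕ) :
    blocks (alternating i j d) = d := by
  induction d generalizing i j with
  | zero => rfl
  | succ d ih =>
    cases d with
    | zero => rfl
    | succ d =>
      have := ih hij.symm
      rw [alternating] at this
      rw [alternating, alternating, blocks_cons_cons, if_pos hij, this, add_comm]

/-- A norm estimate for a continuous linear functional follows from the estimate on monomials. -/
theorem norm_le_of_norm_monomial_le {W : Set (Weight n)} (ω : W) (ℓ : WordAlgebra W →L[ℂ] ℂ) {K : ℝ}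
    (h : ∀ w, ‖ℓ (monomial W w)‖ ≤ K * ω.1.toFun w) (a : WordAlgebra W) :
    ‖ℓ a‖ ≤ K * wordSeminorm W ω a := by
  have hs := (hasSum_monomial W a).map ℓ ℓ.continuous
  rw [← hs.tsum_eq]
  refine tsum_of_norm_bounded ((a.2 ω.1 ω.2).hasSum.mul_left K) fun w => ?_
  simp only [Function.comp_apply, map_smul, norm_smul]
  calc _ ≤ ‖(a : NCSeries n).coeff w‖ * (K * ω.1.toFun w) := by gcongr; exact h w
    _ = _ := by ring

/-- Given an isomorphism `e`, let `ℓ d` be the coefficient at the alternating word of length `d`,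
transported by `e.symm`. Continuity of `e.symm` makes `ℓ d` decay faster than any geometric sequence
in `d`, and interpolation makes this decay hold for one fixed Taylor norm. But `ℓ d` takes the value
`1` on the image of the alternating word, whose norm grows at most geometrically because `e` is
continuous. -/
theorem isEmpty_freePolydisk_equiv_taylor {n : ℕ} (hn : 2 ≤ n) {r : ℝ≥0∞} (hr : 0 < r)
    (hr' : r ≠ ∞) : IsEmpty (FreePolydisk n r ≃L[ℂ] TaylorFreePolydisk n r) := by
  refine ⟨fun e => ?_⟩
  let i : Fin n := ⟨0, by omega⟩
  let j : Fin n := ⟨1, by omega⟩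
  have hij : i ≠ j := by simp [i, j, Fin.ext_iff]
  have := nonempty_taylorWeights n hr
  have := nonempty_polydiskWeights n hr
  obtain ⟨ρ₀, hρ₀, hρ₀r⟩ := exists_ofReal_lt hr
  let ω (R : ℝ) (hR : 1 ≤ R) : polydiskWeights n r := ⟨_, ρ₀, R, hρ₀, hR, hρ₀r, rfl⟩
  let ℓ (d : ℕ) : TaylorFreePolydisk n r →L[ℂ] ℂ :=
    (coeffCLM (alternating i j d) (exists_polydiskWeight_pos hr _)).comp
      (e.symm : TaylorFreePolydisk n r →L[ℂ] FreePolydisk n r)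
  -- Here the radius `ρ` still depends on `R` and may approach `r` as `R` grows.
  have h1 : ∀ R : ℝ, 1 ≤ R → ∃ ρ K : ℝ, 0 < ρ ∧ ρ < r.toReal ∧ 0 < K ∧ ∀ d w,
      ‖ℓ d (monomial _ w)‖ * (ρ₀ * R) ^ d ≤ K * ρ ^ w.length := by
    intro R hR
    obtain ⟨⟨_, ρ, hρ, hρr, rfl⟩, K, hK, hb⟩ := exists_weight_bound (directed_taylorWeights n r)
      ((wordSeminorm _ (ω R hR)).comp (e.symm : TaylorFreePolydisk n r →ₗ[ℂ] FreePolydisk n r))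
      ((continuous_wordSeminorm _ _).comp e.symm.continuous)
    refine ⟨ρ, K, hρ, (ENNReal.ofReal_lt_iff_lt_toReal hρ.le hr').1 hρr, hK, fun d w => ?_⟩
    refine le_trans ?_ (hb w)
    have := norm_coeff_mul_le _ (ω R hR) (e.symm (monomial _ w)) (alternating i j d)
    change _ * (ρ₀ ^ _ * R ^ _) ≤ _ at this
    rw [length_alternating, blocks_alternating hij, ← mul_pow] at this
    exact this
  obtain ⟨ρ₁, K₁, hρ₁, hρ₁r, hK₁, hb₁⟩ := h1 1 le_rfl
  have hr0 : 0 < r.toReal := hρ₁.trans hρ₁r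
  -- The geometric mean of `ρ₁` and `r` is below `r` and independent of `R`; finiteness of `r` is
  -- essential here.
  let ρ := √(ρ₁ * r.toReal)
  have hρ : 0 < ρ := Real.sqrt_pos.2 (by positivity)
  have hρr : ρ < r.toReal := (Real.sqrt_lt' hr0).2 (by nlinarith)
  have hρ2 : ρ ^ 2 = ρ₁ * r.toReal := Real.sq_sqrt (by positivity)
  have h2 : ∀ R : ℝ, 1 ≤ R → ∃ K : ℝ, 0 < K ∧ ∀ d w,
      ‖ℓ d (monomial _ w)‖ ≤ K * ((ρ₀ * R) ^ d)⁻¹ * ρ ^ w.length := by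
    intro R hR
    -- The geometric mean of the bounds for `1` and `R ^ 2` yields the factor `R ^ d`, with radius
    -- at most `√(ρ₁ * r)` since `ρ₂ < r`.
    obtain ⟨ρ₂, K₂, hρ₂, hρ₂r, hK₂, hb₂⟩ := h1 (R ^ 2) (one_le_pow₀ hR)
    refine ⟨√(K₁ * K₂), Real.sqrt_pos.2 (by positivity), fun d w => ?_⟩
    have hpos : 0 < (ρ₀ * R) ^ d := by positivity
    rw [mul_right_comm, ← div_eq_mul_inv, le_div_iff₀ hpos]
    refine le_of_sq_le_sq ?_ (by positivity)
    calc (‖ℓ d (monomial _ w)‖ * (ρ₀ * R) ^ d) ^ 2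
        = (‖ℓ d (monomial _ w)‖ * (ρ₀ * 1) ^ d) * (‖ℓ d (monomial _ w)‖ * (ρ₀ * R ^ 2) ^ d) := by
          ring
      _ ≤ (K₁ * ρ₁ ^ w.length) * (K₂ * ρ₂ ^ w.length) := by
          exact mul_le_mul (hb₁ d w) (hb₂ d w) (by positivity) (by positivity)
      _ ≤ (K₁ * ρ₁ ^ w.length) * (K₂ * r.toReal ^ w.length) := by gcongr
      _ = (√(K₁ * K₂) * ρ ^ w.length) ^ 2 := by
          rw [mul_pow, Real.sq_sqrt (by positivity), ← pow_mul, mul_comm w.length, pow_mul, hρ2]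
          ring
  let ω' : taylorWeights n r := ⟨_, ρ, hρ, (ENNReal.ofReal_lt_iff_lt_toReal hρ.le hr').2 hρr, rfl⟩
  obtain ⟨⟨_, ρ₃, τ, hρ₃, hτ, _, rfl⟩, K₃, hK₃, hb₃⟩ :=
    exists_weight_bound (directed_polydiskWeights n r)
      ((wordSeminorm _ ω').comp (e : FreePolydisk n r →ₗ[ℂ] TaylorFreePolydisk n r))
      ((continuous_wordSeminorm _ _).comp e.continuous)
  -- Chosen so that the decay rate `ρ₀ * R` of `ℓ d` beats the growth rate `ρ₃ * τ` of the images of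
  -- alternating words by a factor `2`; this forces `2 ^ d` to be bounded.
  let R := max 1 (2 * (ρ₃ * τ) / ρ₀)
  have hR : 1 ≤ R := le_max_left _ _
  have hR2 : 2 * (ρ₃ * τ) ≤ ρ₀ * R := by
    rw [mul_comm ρ₀, ← div_le_iff₀ hρ₀]
    exact le_max_right _ _
  obtain ⟨K, hK, hb⟩ := h2 R hR
  have h3 : ∀ d : ℕ, 2 ^ d ≤ K * K₃ := by
    intro d
    have h4 := norm_le_of_norm_monomial_le ω' (ℓ d) (hb d) (e (monomial _ (alternating i j d)))
    have h5 : ℓ d (e (monomial _ (alternating i j d))) = 1 := by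
      change (e.symm (e (monomial _ (alternating i j d))) : NCSeries n).coeff _ = 1
      rw [e.symm_apply_apply]
      exact if_pos rfl
    have h6 : wordSeminorm _ ω' (e (monomial _ (alternating i j d))) ≤ K₃ * (ρ₃ * τ) ^ d := by
      refine (hb₃ (alternating i j d)).trans_eq ?_
      change K₃ * (ρ₃ ^ _ * τ ^ _) = _
      rw [length_alternating, blocks_alternating hij, mul_pow]
    have hpos : 0 < (ρ₃ * τ) ^ d := by positivity
    have hpos' : 0 < (ρ₀ * R) ^ d := by positivity
    rw [h5, norm_one] at h4
    have h7 : (2 * (ρ₃ * τ)) ^ d ≤ K * (K₃ * (ρ₃ * τ) ^ d) := by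
      refine (pow_le_pow_left₀ (by positivity) hR2 d).trans ?_
      rw [mul_right_comm, ← div_eq_mul_inv, le_div_iff₀ hpos', one_mul] at h4
      exact h4.trans (by gcongr)
    rw [mul_pow, ← mul_assoc] at h7
    exact le_of_mul_le_mul_right h7 hpos
  obtain ⟨d, hd⟩ := pow_unbounded_of_one_lt (K * K₃) (one_lt_two : (1 : ℝ) < 2)
  exact absurd (h3 d) hd.not_ge

end FreeDeformation

theorem theorem8p8 (n : ℕ) (r : ℝ≥0∞) (hr : 0 < r) :
    (∃ e : FreeDeformation.ODef n r ≃A[FreeDeformation.Hol ℂ] FreeDeformation.ODefT n r,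
      ∀ x, e x = FreeDeformation.iDD n r x) ∧
    (2 ≤ n → r ≠ ∞ →
      IsEmpty (FreeDeformation.FreePolydisk n r ≃L[ℂ] FreeDeformation.TaylorFreePolydisk n r)) ∧
    FreeDeformation.IsStrictlySpectrallyContractive.{u} r
      (FreeDeformation.defGen (FreeDeformation.polydiskWeights n r)) :=
  ⟨FreeDeformation.exists_iDD_equiv n hr,
    fun hn hr' => FreeDeformation.isEmpty_freePolydisk_equiv_taylor hn hr hr',
    FreeDeformation.isStrictlySpectrallyContractive_defGen n hr⟩
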